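/- For $f\in L^2(\mathbb R)=L^2(\mathbb R;\mathbb C)$ let $\widehat f(k)=(2\pi)^{-1/2}\int_{\mathbb R}e^{-ikx}f(x)\,dx$ be its (unitary) Fourier transform and let $$e^{-t\partial_x^3}f(x)=(2\pi)^{-1/2}\int_{\mathbb R}e^{ixk+itk^3}\widehat f(k)\,dk,\qquad t\in\mathbb R,$$ be the solution of the Airy equation $\partial_tu+\partial_x^3u=0$ with initial datum $f$ (both formulas being understood in the $L^2$ sense). Put $$\mathcal A=\sup\{\|e^{-t\partial_x^3}f\|_{L^8_{t,x}(\mathbb R\times\mathbb R)}:\ f\in L^2(\mathbb R),\ \|f\|_2=1\}.$$ A function $f\in L^2(\mathbb R)$ is called an extremiser of the Airy Strichartz inequality if $f\neq0$ and $\|e^{-t\partial_x^3}f\|_{L^8_{t,x}}=\mathcal A\|f\|_2$. It is called a weak solution of the Euler–Lagrange equation $\omega f=\int e^{t\partial_x^3}\bigl[|e^{-t\partial_x^3}f|^6e^{-t\partial_x^3}f\bigr]dt$ if there is $\omega>0$ such that, for all $g\in L^2(\mathbb R)$, $$\omega\int_{\mathbb R}\overline{g}\,f\,dx=\iint_{\mathbb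 R\times\mathbb R}\overline{e^{-t\partial_x^3}g}\;\overline{e^{-t\partial_x^3}f}^{\,3}\,\bigl(e^{-t\partial_x^3}f\bigr)^4\,dx\,dt .$$ **Theorem.** Let $f\in L^2(\mathbb R)$ be an extremiser of the Airy Strichartz inequality, or a weak solution of the Euler–Lagrange equation. Then there exists $\mu_0>0$ such that $$k\mapsto e^{\mu_0|k|^3}\,\widehat f(k)\in L^2(\mathbb R).$$ In particular, $f$ can be extended to an entire function on $\mathbb C$, i.e. there is an entire function $F$ with $F(x)=f(x)$ for almost every $x\in\mathbb R$. -/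

import Mathlib

noncomputable section

namespace AiryStrichartz

open MeasureTheory
open scoped FourierTransform ENNReal ComplexConjugate

/-- The complex Hilbert space `L²(ℝ)`. -/
abbrev L2 : Type := Lp ℂ 2 (volume : Measure ℝ)

/-- The unitary Fourier transform `f̂(k) = (2π)^{-1/2} ∫ e^{-ikx} f(x) dx` of `f ∈ L²(ℝ)`
(as a function determined up to null sets). Mathlib's `𝓕` on `L²` has the kernel `e^{-2πixξ}`,
so that `f̂(k) = (2π)^{-1/2} (𝓕 f)(k / 2π)`. -/
def fourierHat (f : L2) (k : ℝ) : ℂ :=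
  ((√(2 * Real.pi))⁻¹ : ℝ) * (𝓕 f : L2) (k / (2 * Real.pi))

/-- The symbol `e^{itk³}` of `e^{-t∂ₓ³}` at the frequency `k = 2πξ`. -/
def airySymbol (t ξ : ℝ) : ℂ :=
  Complex.exp (((t * (2 * Real.pi * ξ) ^ 3 : ℝ) : ℂ) * Complex.I)

lemma memLp_airySymbol_mul (t : ℝ) (g : L2) :
    MemLp (fun ξ : ℝ => airySymbol t ξ * g ξ) 2 (volume : Measure ℝ) := by
  have hc : Continuous (airySymbol t) := by
    unfold airySymbol
    fun_prop
  refine (Lp.memLp g).of_le (hc.aestronglyMeasurable.mul (Lp.aestronglyMeasurable g)) ?_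
  refine Filter.Eventually.of_forall fun ξ => ?_
  rw [norm_mul, airySymbol, Complex.norm_exp_ofReal_mul_I, one_mul]

/-- The Airy propagator on `L²(ℝ)`: the Fourier multiplier with symbol `e^{itk³}`, that is
`e^{-t∂ₓ³} f (x) = (2π)^{-1/2} ∫ e^{ixk + itk³} f̂(k) dk` (understood in `L²`). -/
def airy (t : ℝ) (f : L2) : L2 :=
  𝓕⁻ ((memLp_airySymbol_mul t (𝓕 f)).toLp (fun ξ : ℝ => airySymbol t ξ * (𝓕 f : L2) ξ))

/-- The space-time norm `‖e^{-t∂ₓ³} f‖_{L⁸_{t,x}(ℝ × ℝ)} = (∫ ‖e^{-t∂ₓ³} f‖_{L⁸_x}⁸ dt)^{1/8}`,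
with values in `[0, ∞]`. -/
def strichartzNorm (f : L2) : ℝ≥0∞ :=
  (∫⁻ t : ℝ, eLpNorm (airy t f) 8 volume ^ (8 : ℝ)) ^ (1 / 8 : ℝ)

/-- The optimal constant `𝒜 = sup {‖e^{-t∂ₓ³} f‖_{L⁸_{t,x}} : ‖f‖₂ = 1}`. -/
def optimalConstant : ℝ≥0∞ :=
  ⨆ (f : L2) (_ : ‖f‖ = 1), strichartzNorm f

/-- `f` is an extremiser of the Airy Strichartz inequality `‖e^{-t∂ₓ³} f‖_{L⁸} ≤ C ‖f‖_{L²}`. -/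
def IsExtremiser (f : L2) : Prop :=
  f ≠ 0 ∧ strichartzNorm f = optimalConstant * ENNReal.ofReal ‖f‖

/-- The form `Q(f₁, …, f₈) = ∬ ∏_{l = 1}^4 conj (e^{-t∂ₓ³} f_l) ∏_{m = 5}^8 e^{-t∂ₓ³} f_m dx dt`;
`u` lists the four arguments that are conjugated, `v` the four that are not. -/
def airyForm (u v : Fin 4 → L2) : ℂ :=
  ∫ t : ℝ, ∫ x : ℝ, (∏ l, conj (airy t (u l) x)) * ∏ m, airy t (v m) x

/-- `f` is a weak solution of the Euler–Lagrange equation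
`ω f = ∫ e^{t∂ₓ³} [|e^{-t∂ₓ³} f|⁶ e^{-t∂ₓ³} f] dt` for some `ω > 0`:
`ω ⟨g, f⟩ = Q(g, f, …, f)` for all `g ∈ L²`, where `⟨g, f⟩ = ∫ conj g · f`. -/
def IsWeakSolution (f : L2) : Prop :=
  ∃ ω : ℝ, 0 < ω ∧ ∀ g : L2,
    (ω : ℂ) * inner ℂ g f = airyForm ![g, f, f, f] ![f, f, f, f]

/-- `e^{μ₀ |k|³} f̂(k) ∈ L²` for some `μ₀ > 0`. -/
def HasCubicExpFourierDecay (f : L2) : Prop :=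
  ∃ μ₀ : ℝ, 0 < μ₀ ∧
    MemLp (fun k : ℝ => (Real.exp (μ₀ * |k| ^ 3) : ℂ) * fourierHat f k) 2 volume

/-- `f` agrees almost everywhere on `ℝ` with the restriction of an entire function. -/
def ExtendsToEntire (f : L2) : Prop :=
  ∃ F : ℂ → ℂ, Differentiable ℂ F ∧ ∀ᵐ x : ℝ, F (x : ℂ) = f x

end AiryStrichartz

end

/-!
# Cubic exponential Fourier decay of extremisers of the Airy Strichartz inequality

Write `F = 𝓕 f`. By Plancherel in `(t, x)` the form `airyForm` is an integral of a product of eight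
Fourier transforms over the resonant set `∑ kᵢ = 0`, `∑ kᵢ³ = 0`, where the frequencies of the
conjugated factors are counted with the opposite sign. To avoid measures on this singular set, the
space-time integral is cut off by a Gaussian `e^{-δ(t² + x²)}`, which replaces the two delta
functions by approximate identities in `∑ kᵢ` and `∑ kᵢ³` (`resForm`, `enorm_airyForm_le`); all
bounds are uniform in `δ`.

*Multilinear estimate.* Grouping the eight slots into four pairs and applying Hölder's inequality
controls `resForm` by bilinear quantities `pairInt a b`, in which the change of variables
`(k, l) ↦ (k + l, k³ + l³)` with Jacobian `3|k² - l²|` appears (`resForm_le`). They are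
bounded by the masses `∫ a²`, `∫ b²`, with a constant that becomes small when the frequencies of
`a` and `b` are of very different size
(`pairInt_le`, `pairInt_high_low_le`). This contains the Strichartz inequality
(`eLpNorm_wave_le`), and allows to define the evolution of `f` as a function in `L⁸(ℝ × ℝ)`
(`evolution`).

*Exponential weights.* On the resonant set `|k₁|³ ≤ ∑_{i ≠ 1} |kᵢ|³`. For the truncated weight
`G = min (μ|ξ|³, Λ)` this gives `e^{G(k₁)} ≤ ∏_{i ≠ 1} e^{G(kᵢ)}`, up to a factor `e^{|q|}` in
`q = ∑ kᵢ³` that the Gaussian kernel absorbs (`resForm_weight_le`). Testing the Euler–Lagrange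
equation with the datum `e^{2G} F 1_{|ξ| > s²}` bounds the mass `V = ∫_{|ξ| > s²} (e^G |F|)²` of the
weighted high frequencies by the form with one high-frequency slot. Splitting a second slot into low
and high frequencies gives one term with a weakly interacting high-low pair and one term with two
high-frequency slots, which is at most linear in `V` with a coefficient that is small for small `κ`
and `V`:
`ω V ≤ a κ^{3/4} V^{1/2} + b (κ + d V^{2/3})^{3/2} V`, in which `a`, `b`, `d` do not depend on `μ`,
`Λ`, `s` as long as `μ s⁶ ≤ 1` and `V ≤ 1`, while `κ → 0` as `s → ∞` (`weighted_mass_le`).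

*Bootstrap.* For small `κ` the last inequality excludes values of `V` in an interval `(V₀ / 4, V₀]`.
Raising the truncation level `Λ` by `log 2` increases `V` at most by a factor `4`, so that `V`,
which is small for `Λ = 0`, stays below `V₀ / 4` for all `Λ` (`exists_weighted_mass_bound`). Letting
`Λ → ∞` shows that `e^{μ|ξ|³} F` is in `L²`. A cubic exponential beats every `e^{c|ξ|}`, so that
Fourier inversion extends `f` to an entire function.

*Extremisers.* They solve the Euler–Lagrange equation with `ω = 𝒜⁸ ‖f‖⁶`: by the tangent-line
inequality for `|·|⁸` the function `τ ↦ 𝒜⁸ ‖f + τ g‖⁸ - ‖e^{-t∂ₓ³} f‖₈⁸ - 8 τ Re Q(g, f, …, f)`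
is nonnegative, and it vanishes at `τ = 0` (`re_airyForm_eq`).
-/

noncomputable section

namespace AiryStrichartz

open MeasureTheory
open scoped FourierTransform ENNReal ComplexConjugate

/-! ### Change of variables and Hölder's inequality on the resonant set -/

/-- The Jacobian (up to the factor `3`) of `(k, l) ↦ (k + l, k³ + l³)`. -/
def jac (p : ℝ × ℝ) : ℝ≥0∞ := ENNReal.ofReal |p.1 ^ 2 - p.2 ^ 2|

@[fun_prop]
lemma measurable_jac : Measurable jac := by
  unfold jac
  fun_prop

lemma lintegral_quadratic_le {ψ : ℝ → ℝ≥0∞} {p : ℝ} (hp : p ≠ 0) (c : ℝ) :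
    ∫⁻ m, ENNReal.ofReal |2 * p * m| * ψ (3 * p * m ^ 2 + c) ≤ 2 * ∫⁻ x, ψ x := by
  -- `m ↦ 3pm² + c` is injective on each half-line, with derivative `6pm`.
  have key : ∀ S : Set ℝ, MeasurableSet S → Set.InjOn (fun m : ℝ => 3 * p * m ^ 2 + c) S →
      ∫⁻ m in S, ENNReal.ofReal |2 * p * m| * ψ (3 * p * m ^ 2 + c) ≤ ∫⁻ x, ψ x := by
    intro S hS hinj
    have h := lintegral_image_eq_lintegral_abs_deriv_mul (f := fun m : ℝ => 3 * p * m ^ 2 + c)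
      (f' := fun m => 6 * p * m) hS (fun x _ => by
        have := (((hasDerivAt_id x).pow 2).const_mul (3 * p)).add_const c
        convert! this.hasDerivWithinAt using 1
        simp; ring) hinj ψ
    calc _ ≤ ∫⁻ m in S, ENNReal.ofReal |6 * p * m| * ψ (3 * p * m ^ 2 + c) := by
          refine lintegral_mono fun m => ?_
          gcongr ENNReal.ofReal ?_ * _
          rw [mul_assoc, mul_assoc, abs_mul, abs_mul 6]
          gcongr
          norm_num
      _ = _ := h.symm
      _ ≤ _ := setLIntegral_le_lintegral _ _
  have h1 := key (Set.Ioi 0) measurableSet_Ioi (by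
    intro x hx y hy hxy
    have h : x ^ 2 = y ^ 2 := by
      have : 3 * p * x ^ 2 = 3 * p * y ^ 2 := by simpa using hxy
      exact mul_left_cancel₀ (mul_ne_zero (by norm_num) hp) this
    exact (pow_left_inj₀ (le_of_lt hx) (le_of_lt hy) two_ne_zero).1 h)
  have h2 := key (Set.Iic 0) measurableSet_Iic (by
    intro x hx y hy hxy
    have h : x ^ 2 = y ^ 2 := by
      have : 3 * p * x ^ 2 = 3 * p * y ^ 2 := by simpa using hxy
      exact mul_left_cancel₀ (mul_ne_zero (by norm_num) hp) this
    have hx' : 0 ≤ -x := by simpa using hx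
    have hy' : 0 ≤ -y := by simpa using hy
    have := (pow_left_inj₀ hx' hy' two_ne_zero).1 (by simpa using h)
    simpa using this)
  rw [← lintegral_add_compl _ (measurableSet_Ioi (a := (0 : ℝ))), Set.compl_Ioi,
    two_mul (∫⁻ x, ψ x)]
  exact add_le_add h1 h2

/-- The map `(k, l) ↦ (k + l, k³ + l³)` is two-to-one, which bounds integrals against its
Jacobian. -/
theorem lintegral_jac_mul_le {φ ψ : ℝ → ℝ≥0∞} (hφ : Measurable φ) (hψ : Measurable ψ)
    (c d : ℝ) :
    ∫⁻ p : ℝ × ℝ, jac p * (φ (p.1 + p.2 + c) * ψ (p.1 ^ 3 + p.2 ^ 3 + d)) ≤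
      2 * ((∫⁻ x, φ x) * ∫⁻ x, ψ x) := by
  rw [Measure.volume_eq_prod, lintegral_prod _ (by fun_prop)]
  have h1 : ∀ k : ℝ, ∫⁻ l, jac (k, l) * (φ (k + l + c) * ψ (k ^ 3 + l ^ 3 + d)) =
      ∫⁻ s, jac (k, s - k) * (φ (s + c) * ψ (k ^ 3 + (s - k) ^ 3 + d)) := by
    intro k
    rw [← lintegral_sub_right_eq_self _ k]
    simp
  simp only [h1]
  rw [lintegral_lintegral_swap (by fun_prop)]
  calc _ ≤ ∫⁻ s, φ (s + c) * (2 * ∫⁻ x, ψ x) := by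
        refine lintegral_mono_ae ?_
        have : ∀ᵐ s : ℝ, s ≠ 0 := by simp [ae_iff]
        filter_upwards [this] with s hs
        rw [← lintegral_add_right_eq_self _ (s / 2)]
        refine le_trans (le_of_eq ?_) (mul_le_mul_right
          (lintegral_quadratic_le (ψ := ψ) hs (s ^ 3 / 4 + d)) _)
        rw [← lintegral_const_mul _ (by fun_prop)]
        refine lintegral_congr fun m => ?_
        have e1 : (m + s / 2) ^ 2 - (s - (m + s / 2)) ^ 2 = 2 * s * m := by ring
        have e2 : (m + s / 2) ^ 3 + (s - (m + s / 2)) ^ 3 + d =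
            3 * s * m ^ 2 + (s ^ 3 / 4 + d) := by
          ring
        rw [jac, e1, e2]
        ring
    _ = _ := by
        rw [lintegral_mul_const _ (by fun_prop), lintegral_add_right_eq_self]
        ring

/-- Tonelli's theorem for a product of functions of separate variables. -/
theorem lintegral_fin_prod_eq_prod {X : Type*} [MeasureSpace X] [SigmaFinite (volume : Measure X)]
    {n : ℕ} (f : Fin n → X → ℝ≥0∞) (hf : ∀ i, Measurable (f i)) :
    ∫⁻ x : Fin n → X, ∏ i, f i (x i) = ∏ i, ∫⁻ x, f i x := by
  induction n with
  | zero => simp [volume_pi]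
  | succ n ih =>
    rw [← (volume_preserving_piFinSuccAbove (fun _ : Fin (n + 1) => X) 0).symm.lintegral_comp_emb
      (MeasurableEquiv.measurableEmbedding _)]
    simp only [MeasurableEquiv.piFinSuccAbove_symm_apply, Fin.insertNthEquiv,
      Fin.prod_univ_succ, Fin.insertNth_zero, Equiv.coe_fn_mk, Fin.cons_succ, Fin.cons_zero,
      cast_eq]
    rw [← ih (fun i => f i.succ) (fun i => hf _), ← lintegral_prod_mul (hf 0).aemeasurable
      (g := fun x : Fin n → X => ∏ i, f i.succ (x i))
      (Finset.measurable_prod _ fun i _ => (hf _).comp (measurable_pi_apply i)).aemeasurable]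
    rfl

/-- The pair functional: the `4/3`-th power of the `L^{4/3}` norm of the density of the image of
`a(k) b(l) dk dl` under `(k, l) ↦ (k + l, k³ + l³)`, up to a constant. -/
def pairInt (a b : ℝ → ℝ≥0∞) : ℝ≥0∞ :=
  ∫⁻ p : ℝ × ℝ, (a p.1 * b p.2) ^ (4 / 3 : ℝ) * jac p ^ (-1 / 3 : ℝ)

/-- The positive multilinear form: the integral of `∏ aᵢ(kᵢ)` against an approximation
`φ(∑ kᵢ) ψ(∑ kᵢ³)` of the measure on the resonant set `∑ kᵢ = ∑ kᵢ³ = 0`. -/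
def resForm (φ ψ : ℝ → ℝ≥0∞) (a : Fin 4 ⊕ Fin 4 → ℝ → ℝ≥0∞) : ℝ≥0∞ :=
  ∫⁻ k : Fin 4 ⊕ Fin 4 → ℝ, (∏ i, a i (k i)) * (φ (∑ i, k i) * ψ (∑ i, k i ^ 3))

/-- The resonant form with the variables grouped into pairs. -/
lemma resForm_eq_pairs (φ ψ : ℝ → ℝ≥0∞) (a : Fin 4 ⊕ Fin 4 → ℝ → ℝ≥0∞) :
    resForm φ ψ a = ∫⁻ w : Fin 4 → ℝ × ℝ, (∏ j, a (.inl j) (w j).1 * a (.inr j) (w j).2) *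
      (φ (∑ j, ((w j).1 + (w j).2)) * ψ (∑ j, ((w j).1 ^ 3 + (w j).2 ^ 3))) := by
  rw [resForm, ← (volume_measurePreserving_sumPiEquivProdPi_symm
      (fun _ : Fin 4 ⊕ Fin 4 => ℝ)).lintegral_comp_emb (MeasurableEquiv.measurableEmbedding _),
    ← (volume_measurePreserving_arrowProdEquivProdArrow ℝ ℝ (Fin 4)).lintegral_comp_emb
      (MeasurableEquiv.measurableEmbedding _)]
  refine lintegral_congr fun w => ?_
  simp only [Fintype.prod_sum_type, Fintype.sum_sum_type, Finset.prod_mul_distrib,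
    Finset.sum_add_distrib]
  rfl

lemma resForm_perm (φ ψ : ℝ → ℝ≥0∞) (a : Fin 4 ⊕ Fin 4 → ℝ → ℝ≥0∞)
    (e : Fin 4 ⊕ Fin 4 ≃ Fin 4 ⊕ Fin 4) :
    resForm φ ψ (fun i => a (e i)) = resForm φ ψ a := by
  unfold resForm
  conv_rhs => rw [← (volume_measurePreserving_piCongrLeft
    (fun _ : Fin 4 ⊕ Fin 4 => ℝ) e).lintegral_comp_emb (MeasurableEquiv.measurableEmbedding _)]
  refine lintegral_congr fun w => ?_
  set v := MeasurableEquiv.piCongrLeft (fun _ : Fin 4 ⊕ Fin 4 => ℝ) e w with hv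
  have hw : ∀ i, w i = v (e i) := fun i => by
    rw [hv, MeasurableEquiv.coe_piCongrLeft, Equiv.piCongrLeft_apply_apply]
  simp only [hw]
  rw [e.prod_comp (fun i => a i (v i)), e.sum_comp v, e.sum_comp (fun i => v i ^ 3)]

lemma prod_succAbove_rpow (x y : Fin 4 → ℝ≥0∞) (c : ℝ≥0∞) :
    ∏ j, (y j * (∏ i : Fin 3, x (j.succAbove i)) * c) ^ (1 / 4 : ℝ) =
      (∏ j, y j ^ (1 / 4 : ℝ) * x j ^ (3 / 4 : ℝ)) * c := by
  have h4 : (c ^ (1 / 4 : ℝ)) ^ 4 = c := by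
    rw [← ENNReal.rpow_natCast, ← ENNReal.rpow_mul]; norm_num
  have h3 : ∀ j, x j ^ (3 / 4 : ℝ) = (x j ^ (1 / 4 : ℝ)) ^ 3 := fun j => by
    rw [← ENNReal.rpow_natCast, ← ENNReal.rpow_mul]; norm_num
  simp only [ENNReal.mul_rpow_of_nonneg _ _ (show (0 : ℝ) ≤ 1 / 4 by norm_num), h3,
    Fin.prod_univ_four, Fin.prod_univ_three]
  conv_rhs => rw [← h4]
  simp only [show (0 : Fin 4).succAbove (0 : Fin 3) = 1 by decide,
    show (0 : Fin 4).succAbove (1 : Fin 3) = 2 by decide,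
    show (0 : Fin 4).succAbove (2 : Fin 3) = 3 by decide,
    show (1 : Fin 4).succAbove (0 : Fin 3) = 0 by decide,
    show (1 : Fin 4).succAbove (1 : Fin 3) = 2 by decide,
    show (1 : Fin 4).succAbove (2 : Fin 3) = 3 by decide,
    show (2 : Fin 4).succAbove (0 : Fin 3) = 0 by decide,
    show (2 : Fin 4).succAbove (1 : Fin 3) = 1 by decide,
    show (2 : Fin 4).succAbove (2 : Fin 3) = 3 by decide,
    show (3 : Fin 4).succAbove (0 : Fin 3) = 0 by decide,
    show (3 : Fin 4).succAbove (1 : Fin 3) = 1 by decide,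
    show (3 : Fin 4).succAbove (2 : Fin 3) = 2 by decide]
  ring

lemma ae_jac_ne_zero : ∀ᵐ p : ℝ × ℝ, jac p ≠ 0 := by
  rw [Measure.volume_eq_prod]
  refine (Measure.ae_prod_iff_ae_ae ?_).2 (Filter.Eventually.of_forall fun k => ?_)
  · exact measurable_jac (measurableSet_singleton 0).compl
  · have : {l : ℝ | ¬ jac (k, l) ≠ 0} ⊆ {k, -k} := by
      intro l hl
      simp only [jac, ne_eq, ENNReal.ofReal_eq_zero, not_not, Set.mem_ofPred_eq, abs_nonpos_iff,
        sub_eq_zero] at hl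
      rcases sq_eq_sq_iff_eq_or_eq_neg.1 hl with h | h
      · exact Or.inl h.symm
      · exact Or.inr (by simp [h])
    rw [ae_iff]
    exact measure_mono_null this ((Set.toFinite _).measure_zero _)

/-- Hölder's inequality in the form of Young's inequality for the fourfold convolution of
`L^{4/3}` densities. -/
theorem resForm_le {φ ψ : ℝ → ℝ≥0∞} (hφ : Measurable φ) (hψ : Measurable ψ)
    {a : Fin 4 ⊕ Fin 4 → ℝ → ℝ≥0∞} (ha : ∀ i, Measurable (a i)) :
    resForm φ ψ a ≤ 2 * ((∫⁻ x, φ x) * ∫⁻ x, ψ x) *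
      ∏ j, pairInt (a (.inl j)) (a (.inr j)) ^ (3 / 4 : ℝ) := by
  set x : Fin 4 → ℝ × ℝ → ℝ≥0∞ := fun j p =>
    (a (.inl j) p.1 * a (.inr j) p.2) ^ (4 / 3 : ℝ) * jac p ^ (-1 / 3 : ℝ) with hx
  have hxm : ∀ j, Measurable (x j) := fun j => by
    have h1 := ha (.inl j)
    have h2 := ha (.inr j)
    rw [hx]
    fun_prop
  set Φ : (Fin 4 → ℝ × ℝ) → ℝ≥0∞ := fun w =>
    φ (∑ j, ((w j).1 + (w j).2)) * ψ (∑ j, ((w j).1 ^ 3 + (w j).2 ^ 3)) with hΦ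
  have hΦm : Measurable Φ := by rw [hΦ]; fun_prop
  set g : Fin 4 → (Fin 4 → ℝ × ℝ) → ℝ≥0∞ := fun j w =>
    jac (w j) * (∏ i : Fin 3, x (j.succAbove i) (w (j.succAbove i))) * Φ w with hg
  have hgm : ∀ j, Measurable (g j) := fun j => by
    have : ∀ i : Fin 3, Measurable fun w : Fin 4 → ℝ × ℝ =>
      x (j.succAbove i) (w (j.succAbove i)) := fun i => (hxm _).comp (measurable_pi_apply _)
    rw [hg]
    fun_prop
  -- integrating first over the `j`-th pair, where the Jacobian sits
  have hint : ∀ j, ∫⁻ w, g j w ≤ 2 * ((∫⁻ x, φ x) * ∫⁻ x, ψ x) *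
      ∏ i : Fin 3, ∫⁻ p, x (j.succAbove i) p := by
    intro j
    rw [← (volume_preserving_piFinSuccAbove (fun _ : Fin 4 => ℝ × ℝ) j).symm.lintegral_comp_emb
      (MeasurableEquiv.measurableEmbedding _), Measure.volume_eq_prod,
      lintegral_prod_symm (fun w => g j ((MeasurableEquiv.piFinSuccAbove _ j).symm w))
        ((hgm j).comp (MeasurableEquiv.measurable _)).aemeasurable,
      ← lintegral_fin_prod_eq_prod (fun i => x (j.succAbove i)) (fun i => hxm _),
      ← lintegral_const_mul _ (f := fun w : Fin 3 → ℝ × ℝ => ∏ i, x (j.succAbove i) (w i))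
        (Finset.measurable_prod _ fun i _ => (hxm _).comp (measurable_pi_apply i))]
    refine lintegral_mono fun w => ?_
    simp only [hg, hΦ, MeasurableEquiv.piFinSuccAbove_symm_apply, Fin.insertNthEquiv,
      Equiv.coe_fn_mk, Fin.insertNth_apply_same, Fin.insertNth_apply_succAbove,
      Fin.sum_univ_succAbove _ j]
    rw [mul_comm (2 * _)]
    refine le_trans (le_of_eq ?_) (mul_le_mul_right (lintegral_jac_mul_le hφ hψ
      (∑ i, ((w i).1 + (w i).2)) (∑ i, ((w i).1 ^ 3 + (w i).2 ^ 3))) _)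
    rw [← lintegral_const_mul _ (by fun_prop)]
    refine lintegral_congr fun p => ?_
    ring
  have hae : ∀ᵐ w : Fin 4 → ℝ × ℝ, ∀ j, jac (w j) ≠ 0 := by
    rw [ae_all_iff]
    intro j
    exact (Measure.quasiMeasurePreserving_eval (fun _ : Fin 4 => (volume : Measure (ℝ × ℝ))) j).ae
      ae_jac_ne_zero
  calc resForm φ ψ a ≤ ∫⁻ w, ∏ j, g j w ^ (1 / 4 : ℝ) := by
        rw [resForm_eq_pairs]
        refine lintegral_mono_ae ?_
        filter_upwards [hae] with w hw
        simp only [hg]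
        rw [prod_succAbove_rpow (fun j => x j (w j)) (fun j => jac (w j)) (Φ w)]
        refine mul_le_mul_left (le_of_eq (Finset.prod_congr rfl fun j _ => ?_)) _
        have hfin : jac (w j) ≠ ∞ := by simp [jac]
        simp only [hx]
        rw [ENNReal.mul_rpow_of_nonneg _ _ (by norm_num), ← ENNReal.rpow_mul, ← ENNReal.rpow_mul,
          mul_left_comm, ← ENNReal.rpow_add _ _ (hw j) hfin]
        norm_num
    _ ≤ ∏ j, (∫⁻ w, g j w) ^ (1 / 4 : ℝ) :=
        ENNReal.lintegral_prod_norm_pow_le _ (fun j _ => (hgm j).aemeasurable)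
          (by norm_num [Fin.sum_univ_four]) (fun _ _ => by norm_num)
    _ ≤ ∏ j : Fin 4, (1 * (∏ i : Fin 3, ∫⁻ p, x (j.succAbove i) p) *
          (2 * ((∫⁻ x, φ x) * ∫⁻ x, ψ x))) ^ (1 / 4 : ℝ) := by
        gcongr with j
        rw [one_mul, mul_comm]
        exact hint j
    _ = _ := by
        rw [prod_succAbove_rpow (fun j => ∫⁻ p, x j p) (fun _ => 1)]
        simp only [ENNReal.one_rpow, one_mul]
        rw [mul_comm]
        rfl

/-! ### The pair estimate -/

/-- The homogeneous kernel of the weighted Schur-type test behind the pair estimate. -/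
def pairKernel (y : ℝ) : ℝ≥0∞ :=
  ENNReal.ofReal |1 - y ^ 2| ^ (-1 / 2 : ℝ) * ENNReal.ofReal |y| ^ (-1 / 2 : ℝ)

@[fun_prop]
lemma measurable_pairKernel : Measurable pairKernel := by
  unfold pairKernel
  fun_prop

lemma ofReal_rpow_le_of_le {c x r : ℝ} (hx : 0 < x) (hr : r ≤ 0) {y : ℝ} (h : x ≤ y)
    (hc : x ^ r ≤ c) : ENNReal.ofReal y ^ r ≤ ENNReal.ofReal c := by
  rw [ENNReal.ofReal_rpow_of_pos (hx.trans_le h)]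
  exact ENNReal.ofReal_le_ofReal ((Real.rpow_le_rpow_of_nonpos hx h hr).trans hc)

lemma quarter_rpow : (1 / 4 : ℝ) ^ (-1 / 2 : ℝ) ≤ 2 := by
  rw [show (1 / 4 : ℝ) = (2 : ℝ) ^ (-2 : ℝ) by norm_num [Real.rpow_neg],
    ← Real.rpow_mul (by norm_num)]
  norm_num

/-- The local singularity `|y|^{-1/2}` near the origin. -/
def locSing : ℝ → ℝ≥0∞ :=
  (Metric.ball (0 : ℝ) 2).indicator fun y => ENNReal.ofReal |y| ^ (-1 / 2 : ℝ)

lemma measurable_locSing : Measurable locSing :=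
  Measurable.indicator (by fun_prop) Metric.isOpen_ball.measurableSet

lemma lintegral_locSing_lt_top : ∫⁻ y, locSing y < ∞ := by
  rw [locSing, lintegral_indicator Metric.isOpen_ball.measurableSet]
  have h := integrableOn_ball_of_norm_le_rpow (μ := (volume : Measure ℝ)) (C := 1) (α := 1 / 2)
    (r := 2) (f := fun y : ℝ => |y| ^ (-1 / 2 : ℝ)) (by simp) (by norm_num)
    (Filter.Eventually.of_forall fun y => by
      rw [Real.norm_of_nonneg (by positivity), Real.norm_eq_abs, one_mul, neg_div])
    (by have : Measurable fun y : ℝ => |y| ^ (-1 / 2 : ℝ) := by measurability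
        exact this.aestronglyMeasurable)
  refine lt_of_le_of_lt (le_of_eq (lintegral_congr_ae ?_)) h.lintegral_lt_top
  have hne : ∀ᵐ y : ℝ, y ≠ 0 := by simp [ae_iff]
  filter_upwards [ae_restrict_of_ae hne] with y hy
  rw [ENNReal.ofReal_rpow_of_pos (abs_pos.2 hy)]

/-- The kernel has the integrable singularities `0`, `1`, `-1` and decays like `|y|^{-3/2}`. -/
lemma pairKernel_le (y : ℝ) : pairKernel y ≤
    2 * (locSing y + locSing (1 - y) + locSing (1 + y)) +
      ENNReal.ofReal (3 * (1 + ‖y‖) ^ (-(3 / 2) : ℝ)) := by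
  have hneg : (-1 / 2 : ℝ) ≤ 0 := by norm_num
  have h2 : ENNReal.ofReal 2 = 2 := by simp
  have hloc : ∀ z : ℝ, |z| < 2 → locSing z = ENNReal.ofReal |z| ^ (-1 / 2 : ℝ) := fun z hz => by
    rw [locSing, Set.indicator_of_mem (by simpa using hz)]
  have hfac : |1 - y ^ 2| = |1 - y| * |1 + y| := by rw [← abs_mul]; ring_nf
  rcases lt_or_ge |y| (1 / 2) with h | h
  · refine le_trans ?_ (le_trans (mul_le_mul_right
      ((le_self_add (b := locSing (1 - y))).trans (le_self_add (b := locSing (1 + y)))) 2)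
      le_self_add)
    rw [pairKernel, hloc y (by linarith), ← h2]
    gcongr
    refine ofReal_rpow_le_of_le (x := 1 / 4) (by norm_num) hneg ?_ quarter_rpow
    have : y ^ 2 ≤ 1 / 4 := by rw [← sq_abs]; nlinarith [abs_nonneg y]
    rw [abs_of_nonneg (by linarith)]
    linarith
  rcases le_or_gt |y| 2 with h' | h'
  · have hy : ENNReal.ofReal |y| ^ (-1 / 2 : ℝ) ≤ 2 := by
      rw [← h2]
      exact ofReal_rpow_le_of_le (x := 1 / 4) (by norm_num) hneg (by linarith) quarter_rpow
    have hmono : ∀ u v : ℝ, u ≤ v →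
        ENNReal.ofReal v ^ (-1 / 2 : ℝ) ≤ ENNReal.ofReal u ^ (-1 / 2 : ℝ) := fun u v huv => by
      rw [neg_div, ENNReal.rpow_neg, ENNReal.rpow_neg, ENNReal.inv_le_inv]
      gcongr
    rcases le_total 0 y with hy0 | hy0
    · rw [abs_of_nonneg hy0] at h h'
      refine le_trans ?_ (le_trans (mul_le_mul_right
        ((le_add_self (b := locSing y)).trans (le_self_add (b := locSing (1 + y)))) 2)
        le_self_add)
      rw [pairKernel, hloc (1 - y) (by rw [abs_lt]; constructor <;> linarith), mul_comm]
      refine mul_le_mul' hy (hmono _ _ ?_)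
      rw [hfac, abs_of_nonneg (show 0 ≤ 1 + y by linarith)]
      nlinarith [abs_nonneg (1 - y)]
    · rw [abs_of_nonpos hy0] at h h'
      refine le_trans ?_ (le_trans (mul_le_mul_right
        (le_add_self (b := locSing y + locSing (1 - y))) 2) le_self_add)
      rw [pairKernel, hloc (1 + y) (by rw [abs_lt]; constructor <;> linarith), mul_comm]
      refine mul_le_mul' hy (hmono _ _ ?_)
      rw [hfac, abs_of_nonneg (show 0 ≤ 1 - y by linarith)]
      nlinarith [abs_nonneg (1 + y)]
  · refine le_trans ?_ le_add_self
    have hp : 0 < (1 + |y|) / 3 := by positivity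
    have hsq : 3 * ((1 + |y|) / 3) ^ 2 ≤ |1 - y ^ 2| := by
      have : |1 - y ^ 2| = |y| ^ 2 - 1 := by
        rw [sq_abs, abs_sub_comm, abs_of_nonneg]
        nlinarith [sq_abs y]
      nlinarith
    have e1 : ENNReal.ofReal |y| ^ (-1 / 2 : ℝ) ≤
        ENNReal.ofReal (((1 + |y|) / 3) ^ (-1 / 2 : ℝ)) :=
      ofReal_rpow_le_of_le hp hneg (by linarith) le_rfl
    have e2 : ENNReal.ofReal |1 - y ^ 2| ^ (-1 / 2 : ℝ) ≤
        ENNReal.ofReal ((3 * ((1 + |y|) / 3) ^ 2) ^ (-1 / 2 : ℝ)) :=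
      ofReal_rpow_le_of_le (by positivity) hneg hsq le_rfl
    refine (mul_le_mul' e2 e1).trans ?_
    rw [← ENNReal.ofReal_mul (by positivity), Real.norm_eq_abs]
    refine ENNReal.ofReal_le_ofReal (le_of_eq ?_)
    have e3 : 3 * ((1 + |y|) / 3) ^ 2 = (1 + |y|) ^ (2 : ℝ) * 3⁻¹ := by
      rw [Real.rpow_two]; ring
    have hq : 0 < 1 + |y| := by positivity
    rw [e3, Real.mul_rpow (by positivity) (by norm_num), ← Real.rpow_mul hq.le,
      div_eq_mul_inv (1 + |y|), Real.mul_rpow hq.le (by norm_num)]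
    have e4 : ((3 : ℝ)⁻¹) ^ (-1 / 2 : ℝ) * (3⁻¹) ^ (-1 / 2 : ℝ) = 3 := by
      rw [← Real.rpow_add (by norm_num)]
      norm_num [Real.rpow_neg]
    have e5 : (1 + |y|) ^ (2 * (-1 / 2) : ℝ) * (1 + |y|) ^ (-1 / 2 : ℝ) =
        (1 + |y|) ^ (-(3 / 2) : ℝ) := by
      rw [← Real.rpow_add hq]
      norm_num
    rw [← e5]
    linear_combination (1 + |y|) ^ (2 * (-1 / 2) : ℝ) * (1 + |y|) ^ (-1 / 2 : ℝ) * e4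

/-- The integral of the kernel over a set of ratios. -/
def kernelInt (E : Set ℝ) : ℝ≥0∞ := ∫⁻ y in E, pairKernel y

lemma kernelInt_univ_lt_top : kernelInt Set.univ < ∞ := by
  rw [kernelInt, Measure.restrict_univ]
  refine (lintegral_mono pairKernel_le).trans_lt ?_
  have hm := measurable_locSing
  rw [lintegral_add_left (by fun_prop), lintegral_const_mul _ (by fun_prop),
    lintegral_add_left (by fun_prop), lintegral_add_left (by fun_prop),
    lintegral_sub_left_eq_self locSing, lintegral_add_left_eq_self locSing]
  have h1 := lintegral_locSing_lt_top
  have h2 : ∫⁻ y : ℝ, ENNReal.ofReal (3 * (1 + ‖y‖) ^ (-(3 / 2) : ℝ)) < ∞ :=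
    ((integrable_one_add_norm (by norm_num)).const_mul 3).lintegral_lt_top
  exact ENNReal.add_lt_top.2 ⟨ENNReal.mul_lt_top (by simp)
    (ENNReal.add_lt_top.2 ⟨ENNReal.add_lt_top.2 ⟨h1, h1⟩, h1⟩), h2⟩

lemma exists_kernelInt_Icc_le {ε : ℝ≥0∞} (hε : ε ≠ 0) :
    ∃ θ : ℝ, 0 < θ ∧ kernelInt (Set.Icc (-θ) θ) ≤ ε := by
  have h0 := kernelInt_univ_lt_top.ne
  rw [kernelInt, Measure.restrict_univ] at h0
  obtain ⟨δ, hδ, h⟩ := exists_pos_setLIntegral_lt_of_measure_lt h0 hε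
  obtain ⟨θ, hθ, hθδ⟩ : ∃ θ : ℝ, 0 < θ ∧ ENNReal.ofReal (2 * θ) < δ := by
    obtain ⟨r, hr0, hr⟩ := ENNReal.lt_iff_exists_nnreal_btwn.1 hδ
    refine ⟨r / 2, by simpa using hr0, ?_⟩
    rw [mul_div_cancel₀ _ two_ne_zero]
    simpa using hr
  refine ⟨θ, hθ, (h _ ?_).le⟩
  rw [Real.volume_Icc]
  convert hθδ using 2
  ring

/-- By scaling, the weighted integral over `l` at fixed `k` depends only on the ratios `l / k`. -/
lemma lintegral_jac_weight {k : ℝ} (hk : k ≠ 0) {E : Set ℝ} (hE : MeasurableSet E) :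
    ∫⁻ l, jac (k, l) ^ (-1 / 2 : ℝ) *
      (ENNReal.ofReal |k| ^ (1 / 2 : ℝ) * ENNReal.ofReal |l| ^ (-1 / 2 : ℝ)) *
        E.indicator 1 (l / k) = kernelInt E := by
  have hE' : Measurable (E.indicator (1 : ℝ → ℝ≥0∞)) := measurable_one.indicator hE
  rw [← Real.smul_map_volume_mul_left hk, lintegral_smul_measure,
    lintegral_map (by fun_prop) (by fun_prop), kernelInt, ← lintegral_indicator hE, smul_eq_mul,
    ← lintegral_const_mul _ (by fun_prop)]
  refine lintegral_congr fun y => ?_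
  rw [mul_div_cancel_left₀ _ hk]
  by_cases hy : y ∈ E
  · have hK : ENNReal.ofReal |k| ≠ 0 := by simpa using hk
    have hK' : ENNReal.ofReal |k| ≠ ∞ := ENNReal.ofReal_ne_top
    have e1 : jac (k, k * y) = (ENNReal.ofReal |k|) ^ (2 : ℝ) * ENNReal.ofReal |1 - y ^ 2| := by
      rw [ENNReal.ofReal_rpow_of_nonneg (abs_nonneg k) zero_le_two,
        ← ENNReal.ofReal_mul (by positivity), jac]
      congr 1
      simp only [Real.rpow_two]
      rw [← abs_pow, ← abs_mul]
      congr 1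
      ring
    rw [Set.indicator_of_mem hy, Set.indicator_of_mem hy, e1, abs_mul,
      ENNReal.ofReal_mul (abs_nonneg k), ENNReal.mul_rpow_of_ne_top (by simp) (by simp),
      ENNReal.mul_rpow_of_ne_top (by simp) (by simp), ← ENNReal.rpow_mul, pairKernel]
    have : ENNReal.ofReal |k| * (ENNReal.ofReal |k| ^ (2 * (-1 / 2) : ℝ) *
        (ENNReal.ofReal |k| ^ (1 / 2 : ℝ) * ENNReal.ofReal |k| ^ (-1 / 2 : ℝ))) = 1 := by
      rw [← ENNReal.rpow_add _ _ hK hK', ← ENNReal.rpow_add _ _ hK hK']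
      nth_rw 1 [← ENNReal.rpow_one (ENNReal.ofReal |k|)]
      rw [← ENNReal.rpow_add _ _ hK hK']
      norm_num
    calc _ = (ENNReal.ofReal |k| * (ENNReal.ofReal |k| ^ (2 * (-1 / 2) : ℝ) *
        (ENNReal.ofReal |k| ^ (1 / 2 : ℝ) * ENNReal.ofReal |k| ^ (-1 / 2 : ℝ)))) *
          (ENNReal.ofReal |1 - y ^ 2| ^ (-1 / 2 : ℝ) * ENNReal.ofReal |y| ^ (-1 / 2 : ℝ)) := by
          simp only [Pi.one_apply]
          ring
      _ = _ := by rw [this, one_mul]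
  · simp [hy]

lemma jac_swap (k l : ℝ) : jac (k, l) = jac (l, k) := by
  simp [jac, abs_sub_comm]

/-- The pair estimate: `|k² - l²|^{-1/3}` is bounded on `L^{3/2} × L^{3/2}` by Hölder's inequality
with the weight `(|k| / |l|)^{1/2}`; it gains when the ratios `l / k` are confined to a set `E`
where the kernel has a small integral. -/
theorem pairInt_le {a b : ℝ → ℝ≥0∞} (ha : Measurable a) (hb : Measurable b) {E : Set ℝ}
    (hE : MeasurableSet E) (hab : ∀ k l, a k ≠ 0 → b l ≠ 0 → l / k ∈ E) :
    pairInt a b ≤ (kernelInt E * kernelInt Set.univ) ^ (1 / 3 : ℝ) *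
      ((∫⁻ k, a k ^ 2) * ∫⁻ k, b k ^ 2) ^ (2 / 3 : ℝ) := by
  have hE' : Measurable (E.indicator (1 : ℝ → ℝ≥0∞)) := measurable_one.indicator hE
  set A := ∫⁻ k, a k ^ 2
  set B := ∫⁻ k, b k ^ 2
  have hne : ∀ᵐ k : ℝ, k ≠ 0 := by simp [ae_iff]
  set X : Fin 3 → ℝ × ℝ → ℝ≥0∞ := ![fun p => a p.1 ^ 2 * b p.2 ^ 2,
    fun p => a p.1 ^ 2 * (jac (p.1, p.2) ^ (-1 / 2 : ℝ) *
      (ENNReal.ofReal |p.1| ^ (1 / 2 : ℝ) * ENNReal.ofReal |p.2| ^ (-1 / 2 : ℝ)) *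
        E.indicator 1 (p.2 / p.1)),
    fun p => b p.2 ^ 2 * (jac (p.2, p.1) ^ (-1 / 2 : ℝ) *
      (ENNReal.ofReal |p.2| ^ (1 / 2 : ℝ) * ENNReal.ofReal |p.1| ^ (-1 / 2 : ℝ)) *
        Set.univ.indicator 1 (p.1 / p.2))] with hX
  have hXm : ∀ i, Measurable (X i) := by
    intro i
    fin_cases i
    · simp only [hX]
      change Measurable fun p : ℝ × ℝ => a p.1 ^ 2 * b p.2 ^ 2
      fun_prop
    · change Measurable fun p : ℝ × ℝ => a p.1 ^ 2 * (jac (p.1, p.2) ^ (-1 / 2 : ℝ) *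
        (ENNReal.ofReal |p.1| ^ (1 / 2 : ℝ) * ENNReal.ofReal |p.2| ^ (-1 / 2 : ℝ)) *
          E.indicator 1 (p.2 / p.1))
      fun_prop
    · change Measurable fun p : ℝ × ℝ => b p.2 ^ 2 * (jac (p.2, p.1) ^ (-1 / 2 : ℝ) *
        (ENNReal.ofReal |p.2| ^ (1 / 2 : ℝ) * ENNReal.ofReal |p.1| ^ (-1 / 2 : ℝ)) *
          Set.univ.indicator 1 (p.1 / p.2))
      simp only [Set.indicator_univ, Pi.one_apply]
      fun_prop
  have hae : ∀ᵐ p : ℝ × ℝ, p.1 ≠ 0 ∧ p.2 ≠ 0 := by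
    have h1 := (Measure.quasiMeasurePreserving_fst (μ := (volume : Measure ℝ))
      (ν := (volume : Measure ℝ))).ae hne
    have h2 := (Measure.quasiMeasurePreserving_snd (μ := (volume : Measure ℝ))
      (ν := (volume : Measure ℝ))).ae hne
    filter_upwards [h1, h2] with p hp1 hp2 using ⟨hp1, hp2⟩
  have h0 : ∫⁻ p, X 0 p = A * B := by
    change ∫⁻ p : ℝ × ℝ, a p.1 ^ 2 * b p.2 ^ 2 = _
    rw [Measure.volume_eq_prod, lintegral_prod_mul (f := fun k => a k ^ 2) (g := fun k => b k ^ 2)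
      (by fun_prop) (by fun_prop)]
  have h1 : ∫⁻ p, X 1 p = A * kernelInt E := by
    rw [Measure.volume_eq_prod, lintegral_prod _ (hXm 1).aemeasurable,
      ← lintegral_mul_const _ (by fun_prop)]
    refine lintegral_congr_ae ?_
    filter_upwards [hne] with k hk
    rw [← lintegral_jac_weight hk hE, ← lintegral_const_mul _ (by fun_prop)]
    rfl
  have h2 : ∫⁻ p, X 2 p = B * kernelInt Set.univ := by
    rw [Measure.volume_eq_prod, lintegral_prod_symm _ (hXm 2).aemeasurable,
      ← lintegral_mul_const _ (by fun_prop)]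
    refine lintegral_congr_ae ?_
    filter_upwards [hne] with k hk
    rw [← lintegral_jac_weight hk MeasurableSet.univ, ← lintegral_const_mul]
    · rfl
    · simp only [Set.indicator_univ, Pi.one_apply]
      fun_prop
  calc pairInt a b ≤ ∫⁻ p, ∏ i, X i p ^ (1 / 3 : ℝ) := by
        refine lintegral_mono_ae ?_
        filter_upwards [hae, ae_jac_ne_zero] with p ⟨hp1, hp2⟩ hJ
        rcases eq_or_ne (a p.1) 0 with h | h
        · simp [h]
        rcases eq_or_ne (b p.2) 0 with h' | h'
        · simp [h']
        have hJ' : jac p ≠ ∞ := by simp [jac]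
        have hk0 : ENNReal.ofReal |p.1| ≠ 0 := by simpa using hp1
        have hl0 : ENNReal.ofReal |p.2| ≠ 0 := by simpa using hp2
        rw [Fin.prod_univ_three]
        change _ ≤ (a p.1 ^ 2 * b p.2 ^ 2) ^ (1 / 3 : ℝ) *
          (a p.1 ^ 2 * (jac (p.1, p.2) ^ (-1 / 2 : ℝ) *
      (ENNReal.ofReal |p.1| ^ (1 / 2 : ℝ) * ENNReal.ofReal |p.2| ^ (-1 / 2 : ℝ)) *
        E.indicator 1 (p.2 / p.1))) ^ (1 / 3 : ℝ) *
          (b p.2 ^ 2 * (jac (p.2, p.1) ^ (-1 / 2 : ℝ) *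
      (ENNReal.ofReal |p.2| ^ (1 / 2 : ℝ) * ENNReal.ofReal |p.1| ^ (-1 / 2 : ℝ)) *
        Set.univ.indicator 1 (p.1 / p.2))) ^ (1 / 3 : ℝ)
        rw [Set.indicator_of_mem (hab _ _ h h'), Set.indicator_of_mem (Set.mem_univ _),
          jac_swap p.2 p.1]
        simp only [Pi.one_apply, mul_one]
        have h13 : (0 : ℝ) ≤ 1 / 3 := by norm_num
        have h43 : (0 : ℝ) ≤ 4 / 3 := by norm_num
        simp only [ENNReal.mul_rpow_of_nonneg _ _ h13, ENNReal.mul_rpow_of_nonneg _ _ h43,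
          ← ENNReal.rpow_natCast, ← ENNReal.rpow_mul]
        have ea : ∀ x : ℝ≥0∞, x ^ (4 / 3 : ℝ) =
            x ^ (((2 : ℕ) : ℝ) * (1 / 3)) * x ^ (((2 : ℕ) : ℝ) * (1 / 3)) := fun x => by
          rw [← ENNReal.rpow_add_of_nonneg _ _ (by positivity) (by positivity)]
          norm_num
        have ej : jac p ^ (-1 / 3 : ℝ) = jac p ^ (-1 / 2 * (1 / 3) : ℝ) *
            jac p ^ (-1 / 2 * (1 / 3) : ℝ) := by
          rw [← ENNReal.rpow_add _ _ hJ hJ']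
          norm_num
        have ew : ∀ x : ℝ≥0∞, x ≠ 0 → x ≠ ∞ →
            x ^ (1 / 2 * (1 / 3) : ℝ) * x ^ (-1 / 2 * (1 / 3) : ℝ) = 1 := fun x hx hx' => by
          rw [← ENNReal.rpow_add _ _ hx hx']
          norm_num
        rw [ea, ea, ej]
        refine le_of_eq ?_
        calc _ = (a p.1 ^ (((2 : ℕ) : ℝ) * (1 / 3)) * a p.1 ^ (((2 : ℕ) : ℝ) * (1 / 3))) *
              (b p.2 ^ (((2 : ℕ) : ℝ) * (1 / 3)) * b p.2 ^ (((2 : ℕ) : ℝ) * (1 / 3))) *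
              (jac p ^ (-1 / 2 * (1 / 3) : ℝ) * jac p ^ (-1 / 2 * (1 / 3) : ℝ)) *
              (ENNReal.ofReal |p.1| ^ (1 / 2 * (1 / 3) : ℝ) *
                ENNReal.ofReal |p.1| ^ (-1 / 2 * (1 / 3) : ℝ)) *
              (ENNReal.ofReal |p.2| ^ (1 / 2 * (1 / 3) : ℝ) *
                ENNReal.ofReal |p.2| ^ (-1 / 2 * (1 / 3) : ℝ)) := by
              rw [ew _ hk0 ENNReal.ofReal_ne_top, ew _ hl0 ENNReal.ofReal_ne_top]
              ring
          _ = _ := by ring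
    _ ≤ ∏ i, (∫⁻ p, X i p) ^ (1 / 3 : ℝ) :=
        ENNReal.lintegral_prod_norm_pow_le _ (fun j _ => (hXm j).aemeasurable)
          (by norm_num [Fin.sum_univ_three]) (fun _ _ => by norm_num)
    _ = _ := by
        rw [Fin.prod_univ_three, h0, h1, h2]
        have h13 : (0 : ℝ) ≤ 1 / 3 := by norm_num
        have h23 : (A * B) ^ (2 / 3 : ℝ) = (A * B) ^ (1 / 3 : ℝ) * (A * B) ^ (1 / 3 : ℝ) := by
          rw [← ENNReal.rpow_add_of_nonneg _ _ h13 h13]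
          norm_num
        rw [h23]
        simp only [ENNReal.mul_rpow_of_nonneg _ _ h13]
        ring

/-! ### Airy waves with integrable Fourier data -/

/-- The Airy evolution at `p = (t, x)` of the datum with integrable Fourier transform `F`, where
frequencies are normalised as in Mathlib. -/
def wave (F : ℝ → ℂ) (p : ℝ × ℝ) : ℂ :=
  ∫ ξ : ℝ, Complex.exp
    (((2 * Real.pi * p.2 * ξ + p.1 * (2 * Real.pi * ξ) ^ 3 : ℝ) : ℂ) * Complex.I) * F ξ

lemma norm_wave_le (F : ℝ → ℂ) (p : ℝ × ℝ) : ‖wave F p‖ ≤ ∫ ξ, ‖F ξ‖ := by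
  refine (norm_integral_le_integral_norm _).trans (le_of_eq ?_)
  simp_rw [norm_mul, Complex.norm_exp_ofReal_mul_I, one_mul]

lemma continuous_wave {F : ℝ → ℂ} (hF : Integrable F) : Continuous (wave F) := by
  unfold wave
  refine continuous_of_dominated (bound := fun ξ => ‖F ξ‖) (fun p => ?_) (fun p => ?_) hF.norm ?_
  · exact (Continuous.aestronglyMeasurable (by fun_prop)).mul hF.1
  · exact Filter.Eventually.of_forall fun ξ => by
      rw [norm_mul, Complex.norm_exp_ofReal_mul_I, one_mul]
  · exact Filter.Eventually.of_forall fun ξ => by fun_prop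

lemma conj_wave (F : ℝ → ℂ) (p : ℝ × ℝ) :
    conj (wave F p) = wave (fun ξ => conj (F (-ξ))) p := by
  rw [wave, ← integral_conj, ← integral_neg_eq_self, wave]
  refine integral_congr_ae (Filter.Eventually.of_forall fun ξ => ?_)
  simp only [map_mul, ← Complex.exp_conj, Complex.conj_I, Complex.conj_ofReal]
  congr 2
  push_cast
  ring

/-- On `L¹ ∩ L²` the inverse Fourier transform on `L²` is given by the Fourier integral. -/
lemma fourierInv_ae_eq {H : L2} (hH : Integrable H) :
    (𝓕⁻ H : L2) =ᵐ[volume] 𝓕⁻ (H : ℝ → ℂ) := by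
  have hcont : Continuous (𝓕⁻ (H : ℝ → ℂ)) :=
    VectorFourier.fourierIntegral_continuous Real.continuous_fourierChar
      (by exact continuous_inner.neg) hH
  refine ae_eq_of_integral_contDiff_smul_eq ((Lp.memLp _).locallyIntegrable one_le_two)
    hcont.locallyIntegrable fun g hg hgc => ?_
  have hg₁ : HasCompactSupport (Complex.ofRealCLM ∘ g) := hgc.comp_left rfl
  have hg₂ : ContDiff ℝ (⊤ : ℕ∞) (Complex.ofRealCLM ∘ g) := by fun_prop
  set G := hg₁.toSchwartzMap hg₂ with hG
  have hGg : ∀ x, G x = (g x : ℂ) := fun x => rfl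
  calc ∫ x, g x • (𝓕⁻ H : L2) x = Lp.toTemperedDistribution (𝓕⁻ H : L2) G := by
        rw [Lp.toTemperedDistribution_apply]
        simp [hGg]
    _ = Lp.toTemperedDistribution H (𝓕⁻ G) := by
        rw [← Lp.fourierInv_toTemperedDistribution_eq]
        rfl
    _ = ∫ x, 𝓕⁻ (G : ℝ → ℂ) x • H x := by
        rw [Lp.toTemperedDistribution_apply, SchwartzMap.fourierInv_coe]
    _ = ∫ x, G x • 𝓕⁻ (H : ℝ → ℂ) x := by
        have h := VectorFourier.integral_fourierIntegral_smul_eq_flip (L := -innerₗ ℝ)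
          (μ := (volume : Measure ℝ)) (ν := (volume : Measure ℝ))
          Real.continuous_fourierChar (by exact continuous_inner.neg) G.integrable hH
        have hflip : (-innerₗ ℝ).flip = -innerₗ ℝ := by
          ext
          simp
        rw [hflip] at h
        exact h
    _ = _ := by simp [hGg]

lemma airy_ae_eq_wave {f : L2} (hf : Integrable (𝓕 f : L2)) (t : ℝ) :
    airy t f =ᵐ[volume] fun x => wave (𝓕 f : L2) (t, x) := by
  have hm := (memLp_airySymbol_mul t (𝓕 f)).coeFn_toLp
  have hc : Continuous (airySymbol t) := by
    unfold airySymbol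
    fun_prop
  have hi : Integrable (fun ξ => airySymbol t ξ * (𝓕 f : L2) ξ) := by
    refine hf.mono (hc.aestronglyMeasurable.mul hf.1) (Filter.Eventually.of_forall fun ξ => ?_)
    rw [norm_mul, airySymbol, Complex.norm_exp_ofReal_mul_I, one_mul]
  refine (fourierInv_ae_eq (hi.congr hm.symm)).trans (Filter.Eventually.of_forall fun x => ?_)
  rw [Real.fourierInv_eq']
  refine integral_congr_ae ?_
  filter_upwards [hm] with ξ hξ
  rw [hξ, airySymbol, smul_eq_mul, ← mul_assoc, ← Complex.exp_add]
  congr 2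
  simp only [RCLike.inner_apply, conj_trivial]
  push_cast
  ring

/-! ### Gaussian regularisation -/

/-- The Fourier transform `√(π/δ) e^{-s²/4δ}` of `e^{-δx²}`. -/
def gaussHat (δ s : ℝ) : ℝ := √(Real.pi / δ) * Real.exp (-s ^ 2 / (4 * δ))

lemma gaussHat_nonneg (δ s : ℝ) : 0 ≤ gaussHat δ s := by unfold gaussHat; positivity

@[fun_prop]
lemma continuous_gaussHat (δ : ℝ) : Continuous (gaussHat δ) := by
  unfold gaussHat
  fun_prop

lemma integral_gaussian_mul_exp {δ : ℝ} (hδ : 0 < δ) (s : ℝ) :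
    ∫ x : ℝ, (Real.exp (-δ * x ^ 2) : ℂ) * Complex.exp (((s * x : ℝ) : ℂ) * Complex.I) =
      gaussHat δ s := by
  have h := fourierIntegral_gaussian (b := (δ : ℂ)) (by simpa using hδ) (s : ℂ)
  rw [gaussHat]
  convert! h using 1
  · refine integral_congr_ae (Filter.Eventually.of_forall fun x => ?_)
    simp only
    push_cast
    rw [mul_comm]
    congr 2
    ring
  · rw [Real.sqrt_eq_rpow]
    push_cast
    rw [Complex.ofReal_cpow (by positivity)]
    push_cast
    rfl

/-- The Gaussian cut-off in space-time. -/
def gaussCut (δ : ℝ) (p : ℝ × ℝ) : ℝ := Real.exp (-δ * p.1 ^ 2) * Real.exp (-δ * p.2 ^ 2)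

lemma gaussCut_nonneg (δ : ℝ) (p : ℝ × ℝ) : 0 ≤ gaussCut δ p := by unfold gaussCut; positivity

@[fun_prop]
lemma continuous_gaussCut (δ : ℝ) : Continuous (gaussCut δ) := by
  unfold gaussCut
  fun_prop

lemma integrable_gaussCut {δ : ℝ} (hδ : 0 < δ) : Integrable (gaussCut δ) :=
  (integrable_exp_neg_mul_sq hδ).mul_prod (integrable_exp_neg_mul_sq hδ)

lemma integral_gaussCut_mul_exp {δ : ℝ} (hδ : 0 < δ) (a b : ℝ) :
    ∫ p : ℝ × ℝ, (gaussCut δ p : ℂ) *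
      Complex.exp (((b * p.1 + a * p.2 : ℝ) : ℂ) * Complex.I) = gaussHat δ a * gaussHat δ b := by
  rw [← integral_gaussian_mul_exp hδ, ← integral_gaussian_mul_exp hδ, mul_comm,
    Measure.volume_eq_prod, ← integral_prod_mul]
  refine integral_congr_ae (Filter.Eventually.of_forall fun p => ?_)
  simp only [gaussCut]
  push_cast
  rw [add_mul, Complex.exp_add]
  ring

/-- The kernel in the sum of the frequencies produced by the Gaussian cut-off. -/
def kernX (δ s : ℝ) : ℝ≥0∞ := ENNReal.ofReal (gaussHat δ (2 * Real.pi * s))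

/-- The kernel in the sum of the cubes of the frequencies produced by the Gaussian cut-off. -/
def kernT (δ s : ℝ) : ℝ≥0∞ := ENNReal.ofReal (gaussHat δ ((2 * Real.pi) ^ 3 * s))

/-- A product of eight regularised waves is integrated on the Fourier side by Fubini's theorem and
so is bounded by the resonant form of the absolute values. -/
theorem enorm_integral_gaussCut_prod_wave_le {δ : ℝ} (hδ : 0 < δ)
    {H : Fin 4 ⊕ Fin 4 → ℝ → ℂ} (hH : ∀ i, Integrable (H i)) :
    ‖∫ p, (gaussCut δ p : ℂ) * ∏ i, wave (H i) p‖ₑ ≤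
      resForm (kernX δ) (kernT δ) (fun i ξ => ‖H i ξ‖ₑ) := by
  set ph : ℝ × ℝ → (Fin 4 ⊕ Fin 4 → ℝ) → ℂ := fun p k => Complex.exp
    (((((2 * Real.pi) ^ 3 * ∑ i, k i ^ 3) * p.1 + (2 * Real.pi * ∑ i, k i) * p.2 : ℝ) : ℂ) *
      Complex.I) with hph
  have hprod : ∀ p, ∏ i, wave (H i) p = ∫ k : Fin 4 ⊕ Fin 4 → ℝ, ph p k * ∏ i, H i (k i) := by
    intro p
    simp only [wave]
    rw [← integral_fintype_prod_volume_eq_prod]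
    refine integral_congr_ae (Filter.Eventually.of_forall fun k => ?_)
    simp only [Finset.prod_mul_distrib, hph, ← Complex.exp_sum]
    congr 2
    rw [← Finset.sum_mul, ← Complex.ofReal_sum]
    congr 2
    simp only [Finset.mul_sum, Finset.sum_mul, ← Finset.sum_add_distrib]
    exact Finset.sum_congr rfl fun i _ => by ring
  have hHi : Integrable fun k : Fin 4 ⊕ Fin 4 → ℝ => ∏ i, H i (k i) := Integrable.fintype_prod hH
  have hint : Integrable (Function.uncurry fun (p : ℝ × ℝ) (k : Fin 4 ⊕ Fin 4 → ℝ) =>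
      (gaussCut δ p : ℂ) * (ph p k * ∏ i, H i (k i))) (volume.prod volume) := by
    have h1 : Integrable (fun z : (ℝ × ℝ) × (Fin 4 ⊕ Fin 4 → ℝ) =>
        (gaussCut δ z.1 : ℂ) * ∏ i, H i (z.2 i)) (volume.prod volume) :=
      (integrable_gaussCut hδ).ofReal.mul_prod hHi
    have hphc : Continuous fun z : (ℝ × ℝ) × (Fin 4 ⊕ Fin 4 → ℝ) => ph z.1 z.2 := by
      rw [hph]
      fun_prop
    refine (h1.bdd_mul (c := 1) hphc.aestronglyMeasurable ?_).congr ?_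
    · exact Filter.Eventually.of_forall fun z => by
        rw [hph, Complex.norm_exp_ofReal_mul_I]
    · exact Filter.Eventually.of_forall fun z => by
        simp only [Function.uncurry]
        ring
  simp_rw [hprod, ← integral_const_mul]
  rw [integral_integral_swap hint]
  refine (enorm_integral_le_lintegral_enorm _).trans (le_of_eq ?_)
  refine lintegral_congr fun k => ?_
  have : ∫ p, (gaussCut δ p : ℂ) * (ph p k * ∏ i, H i (k i)) =
      (∏ i, H i (k i)) * ((gaussHat δ (2 * Real.pi * ∑ i, k i) *
        gaussHat δ ((2 * Real.pi) ^ 3 * ∑ i, k i ^ 3) : ℝ) : ℂ) := by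
    rw [Complex.ofReal_mul, ← integral_gaussCut_mul_exp hδ, ← integral_const_mul]
    refine integral_congr_ae (Filter.Eventually.of_forall fun p => ?_)
    simp only [hph]
    ring
  rw [this, enorm_mul, kernX, kernT, ← ENNReal.ofReal_mul (gaussHat_nonneg _ _), ← ofReal_norm,
    ← ofReal_norm, Complex.norm_real, norm_prod, Real.norm_of_nonneg (mul_nonneg
      (gaussHat_nonneg _ _) (gaussHat_nonneg _ _)),
    ENNReal.ofReal_prod_of_nonneg fun _ _ => norm_nonneg _]
  simp only [ofReal_norm]

/-- A bound for the masses of the kernels produced by the Gaussian cut-off, uniform in the cut-off,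
even after multiplication by `e^{|s|}`. -/
def kernMass : ℝ≥0∞ := ENNReal.ofReal (Real.exp 2 * (Real.pi * √8))

lemma lintegral_exp_mul_gaussHat_le {δ κ : ℝ} (hδ : 0 < δ) (hδ1 : δ ≤ 1) (hκ : 1 ≤ κ) :
    ∫⁻ s : ℝ, ENNReal.ofReal (Real.exp |s| * gaussHat δ (κ * s)) ≤ kernMass := by
  have hb : (0 : ℝ) < 1 / (8 * δ) := by positivity
  calc _ ≤ ∫⁻ s : ℝ, ENNReal.ofReal (Real.exp 2 * √(Real.pi / δ) *
        Real.exp (-(1 / (8 * δ)) * s ^ 2)) := by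
        refine lintegral_mono fun s => ENNReal.ofReal_le_ofReal ?_
        have : Real.exp |s| * Real.exp (-(κ * s) ^ 2 / (4 * δ)) ≤
            Real.exp 2 * Real.exp (-(1 / (8 * δ)) * s ^ 2) := by
          rw [← Real.exp_add, ← Real.exp_add, Real.exp_le_exp]
          -- arithmetic-geometric mean inequality `|s| ≤ s² / 8δ + 2δ`
          have h1 : |s| ≤ s ^ 2 / (8 * δ) + 2 * δ := by
            have : |s| * (8 * δ) ≤ s ^ 2 + 2 * δ * (8 * δ) := by
              nlinarith [sq_nonneg (|s| - 4 * δ), sq_abs s]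
            rw [← sub_nonneg]
            have e : s ^ 2 / (8 * δ) + 2 * δ - |s| =
              (s ^ 2 + 2 * δ * (8 * δ) - |s| * (8 * δ)) / (8 * δ) := by field_simp
            rw [e]
            exact div_nonneg (by linarith) (by positivity)
          have h2 : s ^ 2 / (4 * δ) ≤ (κ * s) ^ 2 / (4 * δ) := by
            refine div_le_div_of_nonneg_right ?_ (by positivity)
            rw [mul_pow]
            exact le_mul_of_one_le_left (sq_nonneg s) (one_le_pow₀ hκ)
          have h3 : s ^ 2 / (4 * δ) = 2 * (s ^ 2 / (8 * δ)) := by field_simp; ring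
          have h4 : -(1 / (8 * δ)) * s ^ 2 = -(s ^ 2 / (8 * δ)) := by ring
          rw [neg_div, h4]
          linarith
        calc _ = √(Real.pi / δ) * (Real.exp |s| * Real.exp (-(κ * s) ^ 2 / (4 * δ))) := by
              rw [gaussHat]; ring
          _ ≤ √(Real.pi / δ) * (Real.exp 2 * Real.exp (-(1 / (8 * δ)) * s ^ 2)) := by gcongr
          _ = _ := by ring
    _ = ENNReal.ofReal (∫ s : ℝ, Real.exp 2 * √(Real.pi / δ) *
          Real.exp (-(1 / (8 * δ)) * s ^ 2)) := by
        rw [ofReal_integral_eq_lintegral_ofReal ((integrable_exp_neg_mul_sq hb).const_mul _)]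
        exact Filter.Eventually.of_forall fun s => by positivity
    _ = kernMass := by
        rw [integral_const_mul, integral_gaussian, kernMass, mul_assoc, ← Real.sqrt_mul
          (by positivity)]
        congr 2
        rw [show Real.pi / δ * (Real.pi / (1 / (8 * δ))) = Real.pi ^ 2 * 8 by field_simp,
          Real.sqrt_mul (by positivity), Real.sqrt_sq Real.pi_pos.le]

lemma lintegral_kernX_le {δ : ℝ} (hδ : 0 < δ) (hδ1 : δ ≤ 1) : ∫⁻ s, kernX δ s ≤ kernMass := by
  refine (lintegral_mono fun s => ?_).trans (lintegral_exp_mul_gaussHat_le hδ hδ1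
    (κ := 2 * Real.pi) (by linarith [Real.pi_gt_three]))
  exact ENNReal.ofReal_le_ofReal (le_mul_of_one_le_left (gaussHat_nonneg _ _)
    (Real.one_le_exp (abs_nonneg s)))

lemma lintegral_exp_mul_kernT_le {δ : ℝ} (hδ : 0 < δ) (hδ1 : δ ≤ 1) :
    ∫⁻ s, ENNReal.ofReal (Real.exp |s|) * kernT δ s ≤ kernMass := by
  refine (lintegral_mono fun s => ?_).trans (lintegral_exp_mul_gaussHat_le hδ hδ1
    (κ := (2 * Real.pi) ^ 3) (one_le_pow₀ (by linarith [Real.pi_gt_three])))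
  rw [kernT, ENNReal.ofReal_mul (Real.exp_nonneg _)]

lemma lintegral_kernT_le {δ : ℝ} (hδ : 0 < δ) (hδ1 : δ ≤ 1) : ∫⁻ s, kernT δ s ≤ kernMass :=
  (lintegral_mono fun s => le_mul_of_one_le_left zero_le
    (by simp)).trans (lintegral_exp_mul_kernT_le hδ hδ1)

@[fun_prop]
lemma measurable_kernX (δ : ℝ) : Measurable (kernX δ) := by
  unfold kernX
  exact (Continuous.measurable (by fun_prop)).ennreal_ofReal

@[fun_prop]
lemma measurable_kernT (δ : ℝ) : Measurable (kernT δ) := by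
  unfold kernT
  exact (Continuous.measurable (by fun_prop)).ennreal_ofReal

open Filter Topology

/-! ### The Strichartz inequality and the space-time evolution -/

lemma eLpNorm_two_sq {α : Type*} [MeasurableSpace α] (μ : Measure α) (F : α → ℂ) :
    eLpNorm F 2 μ ^ 2 = ∫⁻ x, ‖F x‖ₑ ^ 2 ∂μ := by
  have := eLpNorm_nnreal_pow_eq_lintegral (μ := μ) (f := F) (p := 2) two_ne_zero
  simpa using this

lemma eLpNorm_eight_pow {α : Type*} [MeasurableSpace α] (μ : Measure α) (F : α → ℂ) :
    eLpNorm F 8 μ ^ 8 = ∫⁻ x, ‖F x‖ₑ ^ 8 ∂μ := by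
  have := eLpNorm_nnreal_pow_eq_lintegral (μ := μ) (f := F) (p := 8) (by norm_num)
  simp only [NNReal.coe_ofNat, ENNReal.coe_ofNat] at this
  exact_mod_cast this

lemma lintegral_enorm_sq_neg (F : ℝ → ℂ) : ∫⁻ ξ, ‖F (-ξ)‖ₑ ^ 2 = ∫⁻ ξ, ‖F ξ‖ₑ ^ 2 :=
  lintegral_neg_eq_self (fun ξ => ‖F ξ‖ₑ ^ 2)

/-- The pair estimate without a restriction on the ratios. -/
lemma pairInt_le_univ {a b : ℝ → ℝ≥0∞} (ha : Measurable a) (hb : Measurable b) :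
    pairInt a b ≤ kernelInt Set.univ ^ (2 / 3 : ℝ) *
      ((∫⁻ k, a k ^ 2) * ∫⁻ k, b k ^ 2) ^ (2 / 3 : ℝ) := by
  refine (pairInt_le ha hb MeasurableSet.univ fun _ _ _ _ => Set.mem_univ _).trans (le_of_eq ?_)
  rw [← sq, ← ENNReal.rpow_natCast, ← ENNReal.rpow_mul]
  norm_num

/-- The Strichartz constant obtained from the resonant form. -/
def strichartzConst : ℝ≥0∞ :=
  (2 * (kernMass * kernMass) * (kernelInt Set.univ ^ (1 / 2 : ℝ)) ^ 4) ^ (1 / 8 : ℝ)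

lemma strichartzConst_ne_top : strichartzConst ≠ ∞ := by
  have := kernelInt_univ_lt_top.ne
  have h2 : kernMass ≠ ∞ := ENNReal.ofReal_ne_top
  unfold strichartzConst
  finiteness

/-- The Strichartz inequality, for integrable Fourier data. -/
theorem eLpNorm_wave_le {F : ℝ → ℂ} (hF : Integrable F) (hFm : Measurable F) :
    eLpNorm (wave F) 8 volume ≤ strichartzConst * eLpNorm F 2 volume := by
  set A := ∫⁻ ξ, ‖F ξ‖ₑ ^ 2 with hA
  set H : Fin 4 ⊕ Fin 4 → ℝ → ℂ := Sum.elim (fun _ ξ => conj (F (-ξ))) (fun _ => F) with hH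
  have hHi : ∀ i, Integrable (H i) := by
    rintro (i | i)
    · exact (hF.comp_neg).congr' (by
        exact (continuous_star.comp_aestronglyMeasurable hF.comp_neg.1))
        (Eventually.of_forall fun ξ => by simp [hH])
    · exact hF
  have hHm : ∀ i, Measurable fun ξ => ‖H i ξ‖ₑ := by
    rintro (i | i)
    · simp only [hH, Sum.elim_inl]
      exact (Complex.continuous_conj.measurable.comp (hFm.comp measurable_neg)).enorm
    · exact hFm.enorm
  have hcont := continuous_wave hF
  have hbound : ∀ δ : ℝ, 0 < δ → δ ≤ 1 →
      ∫⁻ p, ENNReal.ofReal (gaussCut δ p) * ‖wave F p‖ₑ ^ 8 ≤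
        (strichartzConst * eLpNorm F 2 volume) ^ 8 := by
    intro δ hδ hδ1
    have e1 : ∀ p, ∏ i, wave (H i) p = ((‖wave F p‖ ^ 8 : ℝ) : ℂ) := by
      intro p
      simp only [Fintype.prod_sum_type, hH, Sum.elim_inl, Sum.elim_inr, ← conj_wave,
        Finset.prod_const, Finset.card_univ, Fintype.card_fin, ← mul_pow, Complex.conj_mul']
      push_cast
      ring
    have e2 : Integrable fun p => gaussCut δ p * ‖wave F p‖ ^ 8 := by
      refine (integrable_gaussCut hδ).mul_bdd (c := (∫ ξ, ‖F ξ‖) ^ 8)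
        (Continuous.aestronglyMeasurable (by fun_prop)) (Eventually.of_forall fun p => ?_)
      rw [norm_pow, norm_norm]
      gcongr
      exact norm_wave_le F p
    calc _ = ‖∫ p, (gaussCut δ p : ℂ) * ∏ i, wave (H i) p‖ₑ := by
          simp_rw [e1, ← Complex.ofReal_mul]
          rw [integral_complex_ofReal, ← ofReal_norm, Complex.norm_real, Real.norm_of_nonneg
            (integral_nonneg fun p => mul_nonneg (gaussCut_nonneg δ p) (by positivity)),
            ofReal_integral_eq_lintegral_ofReal e2
              (Eventually.of_forall fun p => mul_nonneg (gaussCut_nonneg δ p) (by positivity))]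
          refine lintegral_congr fun p => ?_
          rw [ENNReal.ofReal_mul (gaussCut_nonneg δ p), ENNReal.ofReal_pow (norm_nonneg _),
            ofReal_norm]
      _ ≤ resForm (kernX δ) (kernT δ) (fun i ξ => ‖H i ξ‖ₑ) :=
          enorm_integral_gaussCut_prod_wave_le hδ hHi
      _ ≤ 2 * (kernMass * kernMass) *
            ∏ _j : Fin 4,
              (kernelInt Set.univ ^ (2 / 3 : ℝ) * (A * A) ^ (2 / 3 : ℝ)) ^ (3 / 4 : ℝ) := by
          refine (resForm_le (by fun_prop) (by fun_prop) hHm).trans ?_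
          gcongr with j
          · exact lintegral_kernX_le hδ hδ1
          · exact lintegral_kernT_le hδ hδ1
          · refine (pairInt_le_univ (hHm _) (hHm _)).trans (le_of_eq ?_)
            simp only [hH, Sum.elim_inl, Sum.elim_inr, RCLike.enorm_conj, lintegral_enorm_sq_neg]
            rfl
      _ = _ := by
          have h1 : strichartzConst ^ 8 =
              2 * (kernMass * kernMass) * (kernelInt Set.univ ^ (1 / 2 : ℝ)) ^ 4 := by
            rw [strichartzConst, ← ENNReal.rpow_natCast, ← ENNReal.rpow_mul]
            norm_num
          have h2 : (kernelInt Set.univ ^ (2 / 3 : ℝ) * (A * A) ^ (2 / 3 : ℝ)) ^ (3 / 4 : ℝ) =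
              kernelInt Set.univ ^ (1 / 2 : ℝ) * A := by
            rw [ENNReal.mul_rpow_of_nonneg _ _ (by norm_num), ← ENNReal.rpow_mul,
              ← ENNReal.rpow_mul, ← sq, ← ENNReal.rpow_natCast A, ← ENNReal.rpow_mul]
            norm_num
          rw [mul_pow, h1, h2, show (8 : ℕ) = 2 * 4 by norm_num, pow_mul, eLpNorm_two_sq,
            Finset.prod_const, Finset.card_univ, Fintype.card_fin, mul_pow _ A, ← hA]
          ring
  rw [← ENNReal.rpow_le_rpow_iff (z := (8 : ℕ)) (by norm_num), ENNReal.rpow_natCast,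
    ENNReal.rpow_natCast, eLpNorm_eight_pow]
  set d : ℕ → ℝ := fun n => 1 / ((n : ℝ) + 1) with hd
  have hd0 : Tendsto d atTop (𝓝 0) := tendsto_one_div_add_atTop_nhds_zero_nat
  have hlim : ∀ p, Tendsto (fun n => ENNReal.ofReal (gaussCut (d n) p) * ‖wave F p‖ₑ ^ 8) atTop
      (𝓝 (‖wave F p‖ₑ ^ 8)) := by
    intro p
    have h1 : Tendsto (fun n => gaussCut (d n) p) atTop (𝓝 1) := by
      have : Continuous fun δ => gaussCut δ p := by unfold gaussCut; fun_prop
      have := (this.tendsto 0).comp hd0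
      simpa [gaussCut, Function.comp_def] using this
    have h2 := ENNReal.Tendsto.mul_const (ENNReal.tendsto_ofReal h1) (b := ‖wave F p‖ₑ ^ 8)
      (Or.inl (by simp))
    simpa using h2
  calc ∫⁻ p, ‖wave F p‖ₑ ^ 8
      = ∫⁻ p, liminf (fun n => ENNReal.ofReal (gaussCut (d n) p) * ‖wave F p‖ₑ ^ 8) atTop :=
        lintegral_congr fun p => ((hlim p).liminf_eq).symm
    _ ≤ liminf (fun n => ∫⁻ p, ENNReal.ofReal (gaussCut (d n) p) * ‖wave F p‖ₑ ^ 8) atTop :=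
        lintegral_liminf_le fun n => by
          have := hcont.measurable
          fun_prop
    _ ≤ _ := by
        refine liminf_le_of_le (by isBoundedDefault) fun b hb => ?_
        obtain ⟨n, hn⟩ := hb.exists
        refine hn.trans (hbound _ (by positivity) ?_)
        rw [hd, div_le_one (by positivity)]
        linarith [n.cast_nonneg (α := ℝ)]

/-- Sharp truncation to `[-n, n]`. -/
def trunc (F : ℝ → ℂ) (n : ℕ) : ℝ → ℂ := (Set.Icc (-(n : ℝ)) n).indicator F

lemma measurable_trunc {F : ℝ → ℂ} (hF : Measurable F) (n : ℕ) : Measurable (trunc F n) :=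
  hF.indicator measurableSet_Icc

lemma memLp_trunc {F : ℝ → ℂ} (hF : MemLp F 2) (n : ℕ) : MemLp (trunc F n) 2 :=
  hF.indicator measurableSet_Icc

lemma integrable_trunc {F : ℝ → ℂ} (hF : MemLp F 2) (n : ℕ) : Integrable (trunc F n) := by
  rw [trunc, integrable_indicator_iff measurableSet_Icc]
  exact (hF.restrict (Set.Icc (-(n : ℝ)) n)).integrable one_le_two

lemma enorm_trunc_le (F : ℝ → ℂ) (n : ℕ) (ξ : ℝ) : ‖trunc F n ξ‖ₑ ≤ ‖F ξ‖ₑ := by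
  by_cases h : ξ ∈ Set.Icc (-(n : ℝ)) n <;> simp [trunc, h]

lemma norm_trunc_sub_trunc_le (F : ℝ → ℂ) {n m N : ℕ} (hn : N ≤ n) (hm : N ≤ m) (ξ : ℝ) :
    ‖(trunc F n - trunc F m) ξ‖ ≤ ‖(trunc F N - F) ξ‖ := by
  by_cases h : ξ ∈ Set.Icc (-(N : ℝ)) N
  · have hn' : ξ ∈ Set.Icc (-(n : ℝ)) n :=
      Set.Icc_subset_Icc (by simpa using hn) (by simpa using hn) h
    have hm' : ξ ∈ Set.Icc (-(m : ℝ)) m :=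
      Set.Icc_subset_Icc (by simpa using hm) (by simpa using hm) h
    simp [trunc, h, hn', hm']
  · by_cases hn' : ξ ∈ Set.Icc (-(n : ℝ)) n <;> by_cases hm' : ξ ∈ Set.Icc (-(m : ℝ)) m <;>
      simp [trunc, h, hn', hm']

lemma tendsto_eLpNorm_trunc_sub {F : ℝ → ℂ} (hF : MemLp F 2) :
    Tendsto (fun n => eLpNorm (trunc F n - F) 2 volume) atTop (𝓝 0) := by
  have h1 : Tendsto (fun n => ∫⁻ ξ, ‖(trunc F n - F) ξ‖ₑ ^ 2) atTop (𝓝 (∫⁻ _ : ℝ, 0)) := by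
    refine tendsto_lintegral_of_dominated_convergence' (fun ξ => ‖F ξ‖ₑ ^ 2)
      (fun n => (((memLp_trunc hF n).1.sub hF.1).enorm.pow_const 2)) (fun n => ?_) ?_ ?_
    · refine Eventually.of_forall fun ξ => ?_
      by_cases h : ξ ∈ Set.Icc (-(n : ℝ)) n <;> simp [trunc, h]
    · rw [← eLpNorm_two_sq]
      exact ENNReal.pow_ne_top hF.2.ne
    · refine Eventually.of_forall fun ξ => tendsto_const_nhds.congr' ?_
      filter_upwards [eventually_ge_atTop ⌈|ξ|⌉₊] with n hn
      have : |ξ| ≤ n := Nat.ceil_le.1 hn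
      have h : ξ ∈ Set.Icc (-(n : ℝ)) n := abs_le.1 this
      simp [trunc, h]
  simp only [lintegral_zero, ← eLpNorm_two_sq] at h1
  have h2 := (ENNReal.continuous_rpow_const (y := 1 / 2)).tendsto 0 |>.comp h1
  refine (h2.congr fun n => ?_).trans (by simp)
  simp only [Function.comp]
  rw [← ENNReal.rpow_natCast, ← ENNReal.rpow_mul]
  norm_num

lemma wave_sub {F G : ℝ → ℂ} (hF : Integrable F) (hG : Integrable G) :
    wave F - wave G = wave (F - G) := by
  ext p
  have hc : ∀ {F : ℝ → ℂ}, Integrable F → Integrable fun ξ : ℝ => Complex.exp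
    (((2 * Real.pi * p.2 * ξ + p.1 * (2 * Real.pi * ξ) ^ 3 : ℝ) : ℂ) * Complex.I) * F ξ := by
    intro F hF
    refine hF.bdd_mul (c := 1) (Continuous.aestronglyMeasurable (by fun_prop))
      (Eventually.of_forall fun ξ => by rw [Complex.norm_exp_ofReal_mul_I])
  rw [Pi.sub_apply, wave, wave, ← integral_sub (hc hF) (hc hG), wave]
  simp only [Pi.sub_apply, mul_sub]

lemma memLp_wave {F : ℝ → ℂ} (hF : Integrable F) (hFm : Measurable F) (hF2 : MemLp F 2) :
    MemLp (wave F) 8 :=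
  ⟨(continuous_wave hF).aestronglyMeasurable, (eLpNorm_wave_le hF hFm).trans_lt
    (ENNReal.mul_lt_top strichartzConst_ne_top.lt_top hF2.2)⟩

lemma airy_add_smul (t : ℝ) (f g : L2) (c : ℂ) :
    airy t (f + c • g) = airy t f + c • airy t g := by
  have hlin : ∀ a b : L2, (𝓕⁻ (a + c • b) : L2) = 𝓕⁻ a + c • 𝓕⁻ b := fun a b => by
    rw [FourierTransform.fourierInv_add, FourierTransform.fourierInv_smul]
  have h𝓕 : (𝓕 (f + c • g) : L2) = 𝓕 f + c • 𝓕 g := by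
    rw [FourierTransform.fourier_add, FourierTransform.fourier_smul]
  unfold airy
  rw [← hlin, ← MemLp.toLp_const_smul, ← MemLp.toLp_add]
  congr 1
  rw [MemLp.toLp_eq_toLp_iff, h𝓕]
  filter_upwards [Lp.coeFn_add (𝓕 f) (c • 𝓕 g : L2), Lp.coeFn_smul c (𝓕 g : L2)] with ξ hξ hξ'
  rw [hξ]
  simp only [Pi.add_apply, Pi.smul_apply, hξ', smul_eq_mul]
  ring

lemma airy_sub (t : ℝ) (f g : L2) : airy t (f - g) = airy t f - airy t g := by
  simpa [sub_eq_add_neg] using airy_add_smul t f g (-1)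

lemma norm_airy (t : ℝ) (f : L2) : ‖airy t f‖ = ‖f‖ := by
  have hinv : ∀ a : L2, ‖(𝓕⁻ a : L2)‖ = ‖a‖ := (Lp.fourierTransformₗᵢ ℝ ℂ).symm.norm_map
  unfold airy
  rw [hinv, Lp.norm_toLp, ← Lp.norm_fourier_eq f, Lp.norm_def]
  congr 1
  refine eLpNorm_congr_norm_ae (Eventually.of_forall fun ξ => ?_)
  rw [norm_mul, airySymbol, Complex.norm_exp_ofReal_mul_I, one_mul]

/-- Every `f ∈ L²` has a jointly measurable Airy evolution in `L⁸(ℝ × ℝ)`, the limit of the waves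
with truncated Fourier data. -/
theorem exists_evolution (f : L2) : ∃ U : ℝ × ℝ → ℂ, MemLp U 8 ∧
    (∀ᵐ t, airy t f =ᵐ[volume] fun x => U (t, x)) ∧
    Tendsto (fun n => eLpNorm (wave (trunc (𝓕 f : L2) n) - U) 8 volume) atTop (𝓝 0) := by
  set F : ℝ → ℂ := ((𝓕 f : L2) : ℝ → ℂ) with hF
  have hF2 : MemLp F 2 := Lp.memLp _
  have hFm : Measurable F := (Lp.stronglyMeasurable _).measurable
  have hti := fun n => integrable_trunc hF2 n
  have hw : ∀ n, MemLp (wave (trunc F n)) 8 := fun n =>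
    memLp_wave (hti n) (measurable_trunc hFm n) (memLp_trunc hF2 n)
  have : Fact ((1 : ℝ≥0∞) ≤ 8) := ⟨by norm_num⟩
  set W : ℕ → Lp ℂ 8 (volume : Measure (ℝ × ℝ)) := fun n => (hw n).toLp _ with hW
  have hcauchy : CauchySeq W := by
    refine cauchySeq_of_le_tendsto_0'
      (fun N => (strichartzConst * eLpNorm (trunc F N - F) 2 volume).toReal) ?_ ?_
    · intro n m hnm
      rw [Lp.dist_def, hW]
      have hfin : strichartzConst * eLpNorm (trunc F n - F) 2 volume ≠ ∞ :=
        ENNReal.mul_ne_top strichartzConst_ne_top ((memLp_trunc hF2 n).sub hF2).2.ne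
      refine ENNReal.toReal_mono hfin ?_
      rw [eLpNorm_congr_ae ((hw n).coeFn_toLp.sub (hw m).coeFn_toLp), wave_sub (hti n) (hti m)]
      refine (eLpNorm_wave_le ((hti n).sub (hti m))
        ((measurable_trunc hFm n).sub (measurable_trunc hFm m))).trans ?_
      gcongr
      exact eLpNorm_mono fun ξ => norm_trunc_sub_trunc_le F le_rfl hnm ξ
    · have h := ENNReal.Tendsto.const_mul (tendsto_eLpNorm_trunc_sub hF2)
        (Or.inr strichartzConst_ne_top)
      rw [mul_zero] at h
      simpa [Function.comp_def] using (ENNReal.tendsto_toReal ENNReal.zero_ne_top).comp h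
  obtain ⟨V, hU⟩ := cauchySeq_tendsto_of_complete hcauchy
  set U : ℝ × ℝ → ℂ := ⇑V with hUV
  have hU8 : MemLp U 8 := Lp.memLp V
  have hlim : Tendsto (fun n => eLpNorm (wave (trunc F n) - U) 8 volume) atTop (𝓝 0) := by
    rw [Lp.tendsto_Lp_iff_tendsto_eLpNorm'] at hU
    refine hU.congr fun n => eLpNorm_congr_ae ((hw n).coeFn_toLp.sub EventuallyEq.rfl)
  refine ⟨U, hU8, ?_, hlim⟩
  obtain ⟨ns, hns, hae⟩ := (tendstoInMeasure_of_tendsto_eLpNorm (by norm_num)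
    (fun n => (hw n).1) hU8.1 hlim).exists_seq_tendsto_ae
  rw [Measure.volume_eq_prod] at hae
  filter_upwards [Measure.ae_ae_of_ae_prod hae] with t ht
  -- the data with truncated Fourier transform converge at the fixed time `t` in `L²`
  set fn : ℕ → L2 := fun n => 𝓕⁻ ((memLp_trunc hF2 n).toLp _) with hfn
  have hfF : ∀ n, 𝓕 (fn n) = (memLp_trunc hF2 n).toLp _ := fun n =>
    FourierTransform.fourier_fourierInv_eq _
  have hairy : ∀ n, airy t (fn n) =ᵐ[volume] fun x => wave (trunc F n) (t, x) := by
    intro n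
    have hc := (memLp_trunc hF2 n).coeFn_toLp
    have hi : Integrable (𝓕 (fn n) : L2) := by
      rw [hfF]
      exact (hti n).congr hc.symm
    refine (airy_ae_eq_wave hi t).trans (Eventually.of_forall fun x => ?_)
    simp only [wave]
    refine integral_congr_ae ?_
    rw [hfF]
    filter_upwards [hc] with ξ hξ
    rw [hξ]
  have hconv : Tendsto (fun n => airy t (fn n)) atTop (𝓝 (airy t f)) := by
    rw [tendsto_iff_norm_sub_tendsto_zero]
    simp_rw [← airy_sub, norm_airy, ← Lp.norm_fourier_eq (_ - f)]
    have h𝓕 : ∀ n, 𝓕 (fn n - f) = (memLp_trunc hF2 n).toLp _ - 𝓕 f := fun n => by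
      rw [← hfF]
      exact (Lp.fourierTransformₗᵢ ℝ ℂ).map_sub _ f
    simp_rw [h𝓕]
    rw [← tendsto_iff_norm_sub_tendsto_zero, Lp.tendsto_Lp_iff_tendsto_eLpNorm']
    exact (tendsto_eLpNorm_trunc_sub hF2).congr fun n =>
      (eLpNorm_congr_ae ((memLp_trunc hF2 n).coeFn_toLp.sub EventuallyEq.rfl)).symm
  obtain ⟨ms, hms, hae'⟩ := (tendstoInMeasure_of_tendsto_Lp
    (hconv.comp hns.tendsto_atTop)).exists_seq_tendsto_ae
  filter_upwards [ht, hae', ae_all_iff.2 hairy] with x hx hx' hxa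
  refine tendsto_nhds_unique hx' ?_
  refine (hx.comp hms.tendsto_atTop).congr fun n => ?_
  simp only [Function.comp]
  exact (hxa _).symm

/-- The Airy evolution of `f ∈ L²` as a function on space-time. -/
def evolution (f : L2) : ℝ × ℝ → ℂ := (exists_evolution f).choose

lemma memLp_evolution (f : L2) : MemLp (evolution f) 8 := (exists_evolution f).choose_spec.1

lemma airy_ae_eq_evolution (f : L2) :
    ∀ᵐ t, airy t f =ᵐ[volume] fun x => evolution f (t, x) :=
  (exists_evolution f).choose_spec.2.1

lemma tendsto_evolution (f : L2) :
    Tendsto (fun n => eLpNorm (wave (trunc (𝓕 f : L2) n) - evolution f) 8 volume) atTop (𝓝 0) :=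
  (exists_evolution f).choose_spec.2.2

/-! ### The eight-linear form in Fourier variables -/

section Products

variable {α ι : Type*} [MeasurableSpace α] {μ : Measure α}

lemma tendsto_eLpNorm_mul_sub {p q r : ℝ≥0∞} [hpqr : p.HolderTriple q r]
    {A B : ℕ → α → ℂ} {a b : α → ℂ}
    (hA : ∀ n, MemLp (A n) p μ) (hB : ∀ n, MemLp (B n) q μ) (ha : MemLp a p μ) (hb : MemLp b q μ)
    (hAa : Tendsto (fun n => eLpNorm (A n - a) p μ) atTop (𝓝 0))
    (hBb : Tendsto (fun n => eLpNorm (B n - b) q μ) atTop (𝓝 0)) :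
    Tendsto (fun n => eLpNorm (A n * B n - a * b) r μ) atTop (𝓝 0) := by
  have hmul : ∀ {X Y : α → ℂ}, AEStronglyMeasurable X μ → AEStronglyMeasurable Y μ →
      eLpNorm (X * Y) r μ ≤ eLpNorm X p μ * eLpNorm Y q μ := fun {X Y} hX hY => by
    have := eLpNorm_smul_le_mul_eLpNorm (p := p) (q := q) (r := r) hY hX
    rwa [smul_eq_mul] at this
  have h : ∀ n, eLpNorm (A n * B n - a * b) r μ ≤ ENNReal.LpAddConst r * (ENNReal.LpAddConst r *
      (eLpNorm (A n - a) p μ * eLpNorm (B n - b) q μ + eLpNorm (A n - a) p μ * eLpNorm b q μ) +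
        eLpNorm a p μ * eLpNorm (B n - b) q μ) := by
    intro n
    have hAs := ((hA n).sub ha).1
    have hBs := ((hB n).sub hb).1
    have e : A n * B n - a * b = ((A n - a) * (B n - b) + (A n - a) * b) + a * (B n - b) := by ring
    rw [e]
    refine (eLpNorm_add_le' ((hAs.mul hBs).add (hAs.mul hb.1)) (ha.1.mul hBs) r).trans ?_
    gcongr
    · refine (eLpNorm_add_le' (hAs.mul hBs) (hAs.mul hb.1) r).trans ?_
      gcongr
      · exact hmul hAs hBs
      · exact hmul hAs hb.1
    · exact hmul ha.1 hBs
  refine tendsto_of_tendsto_of_tendsto_of_le_of_le tendsto_const_nhds ?_ (fun _ => zero_le) h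
  have hc : ENNReal.LpAddConst r ≠ ∞ := (ENNReal.LpAddConst_lt_top r).ne
  have h1 := ENNReal.Tendsto.mul hAa (by simp) hBb (by simp)
  have h2 := ENNReal.Tendsto.mul_const hAa (b := eLpNorm b q μ) (Or.inr hb.2.ne)
  have h3 := ENNReal.Tendsto.const_mul hBb (a := eLpNorm a p μ) (Or.inr ha.2.ne)
  have h4 := ENNReal.Tendsto.const_mul (h1.add h2) (a := ENNReal.LpAddConst r) (Or.inr hc)
  have h5 := ENNReal.Tendsto.const_mul (h4.add h3) (a := ENNReal.LpAddConst r) (Or.inr hc)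
  simpa using h5

lemma tendsto_eLpNorm_prod_sub {p : ι → ℝ≥0∞} {A : ℕ → ι → α → ℂ} {a : ι → α → ℂ}
    (hA : ∀ n i, MemLp (A n i) (p i) μ) (ha : ∀ i, MemLp (a i) (p i) μ)
    (hAa : ∀ i, Tendsto (fun n => eLpNorm (A n i - a i) (p i) μ) atTop (𝓝 0)) (s : Finset ι) :
    Tendsto (fun n => eLpNorm (∏ i ∈ s, A n i - ∏ i ∈ s, a i) (∑ i ∈ s, (p i)⁻¹)⁻¹ μ)
      atTop (𝓝 0) := by
  induction s using Finset.cons_induction with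
  | empty => simp
  | cons i s hi ih =>
    simp_rw [Finset.prod_cons]
    exact tendsto_eLpNorm_mul_sub (hpqr := ⟨by simp⟩) (fun n => hA n i)
      (fun n => MemLp.prod fun i _ => hA n i) (ha i) (MemLp.prod fun i _ => ha i) (hAa i) ih

end Products

lemma sum_inv_eight : (∑ _i : Fin 4 ⊕ Fin 4, (8 : ℝ≥0∞)⁻¹)⁻¹ = 1 := by
  simp only [Finset.sum_const, Finset.card_univ, Fintype.card_sum, Fintype.card_fin, nsmul_eq_mul]
  norm_num
  exact ENNReal.mul_inv_cancel (by norm_num) (by norm_num)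

/-- The eight factors of the form, those in the first four slots being conjugated. -/
def formFactor (U V : Fin 4 → ℝ × ℝ → ℂ) : Fin 4 ⊕ Fin 4 → ℝ × ℝ → ℂ :=
  Sum.elim (fun l p => conj (U l p)) V

lemma memLp_conj {α : Type*} [MeasurableSpace α] {μ : Measure α} {p : ℝ≥0∞} {U : α → ℂ}
    (hU : MemLp U p μ) : MemLp (fun x => conj (U x)) p μ :=
  hU.congr_norm (Complex.continuous_conj.comp_aestronglyMeasurable hU.1)
    (Eventually.of_forall fun x => by simp)

lemma memLp_formFactor {U V : Fin 4 → ℝ × ℝ → ℂ} (hU : ∀ l, MemLp (U l) 8)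
    (hV : ∀ l, MemLp (V l) 8) (i : Fin 4 ⊕ Fin 4) : MemLp (formFactor U V i) 8 := by
  rcases i with l | l
  · exact memLp_conj (hU l)
  · exact hV l

lemma integrable_prod_formFactor {U V : Fin 4 → ℝ × ℝ → ℂ} (hU : ∀ l, MemLp (U l) 8)
    (hV : ∀ l, MemLp (V l) 8) : Integrable (∏ i, formFactor U V i) := by
  have := MemLp.prod (s := Finset.univ) (p := fun _ => 8) fun i _ => memLp_formFactor hU hV i
  rw [sum_inv_eight] at this
  exact memLp_one_iff_integrable.1 this

/-- The form as an integral over space-time of the product of the eight evolutions. -/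
lemma airyForm_eq_integral (u v : Fin 4 → L2) :
    airyForm u v =
      ∫ p, (∏ i, formFactor (fun l => evolution (u l)) (fun l => evolution (v l)) i) p := by
  have hi := integrable_prod_formFactor (fun l => memLp_evolution (u l))
    (fun l => memLp_evolution (v l))
  rw [Measure.volume_eq_prod] at hi ⊢
  rw [integral_prod _ hi, airyForm]
  refine integral_congr_ae ?_
  filter_upwards [ae_all_iff.2 fun l => airy_ae_eq_evolution (u l),
    ae_all_iff.2 fun l => airy_ae_eq_evolution (v l)] with t hu hv
  refine integral_congr_ae ?_
  filter_upwards [ae_all_iff.2 hu, ae_all_iff.2 hv] with x hux hvx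
  simp [formFactor, hux, hvx, Finset.prod_apply]

lemma tendsto_integral_gaussCut {G : ℝ × ℝ → ℂ} (hG : Integrable G) :
    Tendsto (fun n : ℕ => ∫ p, (gaussCut (1 / ((n : ℝ) + 1)) p : ℂ) * G p) atTop
      (𝓝 (∫ p, G p)) := by
  refine tendsto_integral_of_dominated_convergence (fun p => ‖G p‖) (fun n => ?_) hG.norm
    (fun n => ?_) ?_
  · exact (Continuous.aestronglyMeasurable (by fun_prop)).mul hG.1
  · refine Eventually.of_forall fun p => ?_
    rw [norm_mul, Complex.norm_real, Real.norm_of_nonneg (gaussCut_nonneg _ _)]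
    refine mul_le_of_le_one_left (norm_nonneg _) ?_
    rw [gaussCut, ← Real.exp_add, Real.exp_le_one_iff]
    have : 0 ≤ 1 / ((n : ℝ) + 1) := by positivity
    nlinarith [mul_nonneg this (sq_nonneg p.1), mul_nonneg this (sq_nonneg p.2)]
  · refine Eventually.of_forall fun p => ?_
    have h1 : Tendsto (fun n : ℕ => (gaussCut (1 / ((n : ℝ) + 1)) p : ℂ)) atTop (𝓝 1) := by
      have : Continuous fun δ => (gaussCut δ p : ℂ) := by unfold gaussCut; fun_prop
      have := (this.tendsto 0).comp (tendsto_one_div_add_atTop_nhds_zero_nat (𝕜 := ℝ))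
      simpa [gaussCut, Function.comp_def] using this
    simpa using h1.mul_const (G p)

/-- The absolute values of the Fourier data of the eight factors, those of the conjugated factors
being reflected. -/
def formData (u v : Fin 4 → L2) : Fin 4 ⊕ Fin 4 → ℝ → ℝ≥0∞ :=
  Sum.elim (fun l ξ => ‖(𝓕 (u l) : L2) (-ξ)‖ₑ) (fun l ξ => ‖(𝓕 (v l) : L2) ξ‖ₑ)

/-- The form is bounded by its regularised resonant counterpart. -/
theorem enorm_airyForm_le {u v : Fin 4 → L2} {X : ℝ≥0∞}
    (hX : ∀ δ : ℝ, 0 < δ → δ ≤ 1 → resForm (kernX δ) (kernT δ) (formData u v) ≤ X) :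
    ‖airyForm u v‖ₑ ≤ X := by
  have hF2 : ∀ w : L2, MemLp ((𝓕 w : L2) : ℝ → ℂ) 2 := fun w => Lp.memLp _
  have hFm : ∀ w : L2, Measurable ((𝓕 w : L2) : ℝ → ℂ) := fun w =>
    (Lp.stronglyMeasurable _).measurable
  set wn : L2 → ℕ → ℝ × ℝ → ℂ := fun w n => wave (trunc (𝓕 w : L2) n) with hwn
  have hw8 : ∀ w n, MemLp (wn w n) 8 := fun w n =>
    memLp_wave (integrable_trunc (hF2 w) n) (measurable_trunc (hFm w) n) (memLp_trunc (hF2 w) n)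
  set P : ℕ → ℝ × ℝ → ℂ := fun n =>
    ∏ i, formFactor (fun l => wn (u l) n) (fun l => wn (v l) n) i with hP
  have hPi : ∀ n, Integrable (P n) := fun n =>
    integrable_prod_formFactor (fun l => hw8 _ n) (fun l => hw8 _ n)
  have hlim : Tendsto (fun n => ∫ p, P n p) atTop (𝓝 (airyForm u v)) := by
    rw [airyForm_eq_integral]
    refine tendsto_integral_of_L1' _ (integrable_prod_formFactor (fun l => memLp_evolution (u l))
      (fun l => memLp_evolution (v l))).1 (Eventually.of_forall hPi) ?_
    have h := tendsto_eLpNorm_prod_sub (p := fun _ : Fin 4 ⊕ Fin 4 => 8)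
      (A := fun n => formFactor (fun l => wn (u l) n) (fun l => wn (v l) n))
      (fun n => memLp_formFactor (fun l => hw8 _ n) (fun l => hw8 _ n))
      (memLp_formFactor (fun l => memLp_evolution (u l)) (fun l => memLp_evolution (v l))) ?_
      Finset.univ
    · rw [sum_inv_eight] at h
      exact h
    · rintro (l | l)
      · refine (tendsto_evolution (u l)).congr fun n => eLpNorm_congr_norm_ae ?_
        refine Eventually.of_forall fun p => ?_
        simp only [formFactor, Sum.elim_inl, Pi.sub_apply, ← map_sub, RCLike.norm_conj, hwn]
      · exact tendsto_evolution (v l)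
  refine le_of_tendsto hlim.enorm (Eventually.of_forall fun n => ?_)
  refine le_of_tendsto (tendsto_integral_gaussCut (hPi n)).enorm (Eventually.of_forall fun m => ?_)
  have hδ : (0 : ℝ) < 1 / ((m : ℝ) + 1) := by positivity
  have hδ1 : 1 / ((m : ℝ) + 1) ≤ 1 := by
    rw [div_le_one (by positivity)]
    linarith [m.cast_nonneg (α := ℝ)]
  set H : Fin 4 ⊕ Fin 4 → ℝ → ℂ := Sum.elim
    (fun l ξ => conj (trunc (𝓕 (u l) : L2) n (-ξ))) (fun l => trunc (𝓕 (v l) : L2) n) with hH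
  have hHi : ∀ i, Integrable (H i) := by
    rintro (l | l)
    · exact memLp_one_iff_integrable.1 (memLp_conj (memLp_one_iff_integrable.2
        (integrable_trunc (hF2 (u l)) n).comp_neg))
    · exact integrable_trunc (hF2 (v l)) n
  have hPH : ∀ p, P n p = ∏ i, wave (H i) p := by
    intro p
    simp only [hP, Finset.prod_apply]
    refine Finset.prod_congr rfl fun i _ => ?_
    rcases i with l | l
    · simp only [formFactor, Sum.elim_inl, hwn, hH, conj_wave]
    · rfl
  simp_rw [hPH]
  refine (enorm_integral_gaussCut_prod_wave_le hδ hHi).trans ((lintegral_mono fun k => ?_).trans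
    (hX _ hδ hδ1))
  gcongr with i
  rcases i with l | l
  · simp only [hH, formData, Sum.elim_inl, RCLike.enorm_conj]
    exact enorm_trunc_le _ _ _
  · exact enorm_trunc_le _ _ _

/-! ### Exponential weights on the resonant set -/

/-- The truncated cubic weight `min (μ|ξ|³, Λ)`. -/
def cubicWeight (μ Λ ξ : ℝ) : ℝ := min (μ * |ξ| ^ 3) Λ

@[fun_prop]
lemma continuous_cubicWeight (μ Λ : ℝ) : Continuous (cubicWeight μ Λ) := by
  unfold cubicWeight
  fun_prop

lemma cubicWeight_neg (μ Λ ξ : ℝ) : cubicWeight μ Λ (-ξ) = cubicWeight μ Λ ξ := by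
  simp [cubicWeight]

lemma cubicWeight_nonneg {μ Λ : ℝ} (hμ : 0 ≤ μ) (hΛ : 0 ≤ Λ) (ξ : ℝ) :
    0 ≤ cubicWeight μ Λ ξ := le_min (by positivity) hΛ

/-- Truncation preserves subadditivity: either some term on the right already reaches the level
`Λ`, or none of them is truncated. -/
lemma cubicWeight_le_sum {ι : Type*} {μ Λ : ℝ} (hμ : 0 ≤ μ) (hμ1 : μ ≤ 1) (hΛ : 0 ≤ Λ)
    (s : Finset ι) (k : ι → ℝ) {x r : ℝ} (hr : 0 ≤ r)
    (hx : |x| ^ 3 ≤ (∑ i ∈ s, |k i| ^ 3) + r) :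
    cubicWeight μ Λ x ≤ (∑ i ∈ s, cubicWeight μ Λ (k i)) + r := by
  by_cases h : ∃ i ∈ s, Λ ≤ μ * |k i| ^ 3
  · obtain ⟨i, hi, hΛi⟩ := h
    have h1 : cubicWeight μ Λ (k i) = Λ := min_eq_right hΛi
    have h2 := Finset.single_le_sum (f := fun i => cubicWeight μ Λ (k i))
      (fun j _ => cubicWeight_nonneg hμ hΛ (k j)) hi
    have h3 : cubicWeight μ Λ x ≤ Λ := min_le_right _ _
    simp only [h1] at h2
    linarith
  · push Not at h
    have h1 : ∑ i ∈ s, cubicWeight μ Λ (k i) = ∑ i ∈ s, μ * |k i| ^ 3 :=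
      Finset.sum_congr rfl fun i hi => min_eq_left (h i hi).le
    rw [h1, ← Finset.mul_sum]
    have h2 : cubicWeight μ Λ x ≤ μ * |x| ^ 3 := min_le_left _ _
    nlinarith [mul_le_mul_of_nonneg_left hx hμ]

/-- The exponential of the truncated cubic weight. -/
def expWeight (μ Λ ξ : ℝ) : ℝ≥0∞ := ENNReal.ofReal (Real.exp (cubicWeight μ Λ ξ))

@[fun_prop]
lemma measurable_expWeight (μ Λ : ℝ) : Measurable (expWeight μ Λ) :=
  (Continuous.measurable (by fun_prop)).ennreal_ofReal

/-- Since `|k₁|³ ≤ ∑_{i ≠ 1} |kᵢ|³ + |∑ kᵢ³|`, a weight `e^G` on one slot can be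
distributed over the other slots, at the price of a factor `e^{|q|}` in the kernel. -/
lemma resForm_weight_le {μ Λ : ℝ} (hμ : 0 ≤ μ) (hμ1 : μ ≤ 1) (hΛ : 0 ≤ Λ)
    (φ ψ : ℝ → ℝ≥0∞) (R m : ℝ → ℝ≥0∞) (i₀ : Fin 4 ⊕ Fin 4) :
    resForm φ ψ (fun i => if i = i₀ then fun ξ => expWeight μ Λ ξ * R ξ else m) ≤
      resForm φ (fun q => ENNReal.ofReal (Real.exp |q|) * ψ q)
        (fun i => if i = i₀ then R else fun ξ => expWeight μ Λ ξ * m ξ) := by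
  refine lintegral_mono fun k => ?_
  rw [← Finset.mul_prod_erase Finset.univ _ (Finset.mem_univ i₀),
    ← Finset.mul_prod_erase Finset.univ _ (Finset.mem_univ i₀)]
  beta_reduce
  rw [if_pos rfl, if_pos rfl]
  have h1 : ∏ i ∈ Finset.univ.erase i₀,
      (if i = i₀ then fun ξ => expWeight μ Λ ξ * R ξ else m) (k i) =
      ∏ i ∈ Finset.univ.erase i₀, m (k i) :=
    Finset.prod_congr rfl fun i hi => by rw [if_neg (Finset.ne_of_mem_erase hi)]
  have h2 : ∏ i ∈ Finset.univ.erase i₀,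
      (if i = i₀ then R else fun ξ => expWeight μ Λ ξ * m ξ) (k i) =
      (∏ i ∈ Finset.univ.erase i₀, expWeight μ Λ (k i)) * ∏ i ∈ Finset.univ.erase i₀, m (k i) := by
    rw [← Finset.prod_mul_distrib]
    exact Finset.prod_congr rfl fun i hi => by rw [if_neg (Finset.ne_of_mem_erase hi)]
  have h3 : expWeight μ Λ (k i₀) ≤ (∏ i ∈ Finset.univ.erase i₀, expWeight μ Λ (k i)) *
      ENNReal.ofReal (Real.exp |∑ i, k i ^ 3|) := by
    simp only [expWeight]
    rw [← ENNReal.ofReal_prod_of_nonneg fun _ _ => (Real.exp_pos _).le, ← Real.exp_sum,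
      ← ENNReal.ofReal_mul (Real.exp_pos _).le, ← Real.exp_add]
    refine ENNReal.ofReal_le_ofReal (Real.exp_le_exp.2 ?_)
    refine cubicWeight_le_sum hμ hμ1 hΛ _ k (abs_nonneg _) ?_
    have hs := Finset.add_sum_erase Finset.univ (fun i => k i ^ 3) (Finset.mem_univ i₀)
    have e : k i₀ ^ 3 = ∑ i, k i ^ 3 - ∑ i ∈ Finset.univ.erase i₀, k i ^ 3 := by linarith
    rw [← abs_pow, e]
    refine (abs_sub _ _).trans ?_
    rw [add_comm]
    gcongr
    refine (Finset.abs_sum_le_sum_abs _ _).trans (le_of_eq ?_)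
    exact Finset.sum_congr rfl fun i _ => abs_pow _ _
  rw [h1, h2]
  calc _ = expWeight μ Λ (k i₀) * (R (k i₀) * (∏ i ∈ Finset.univ.erase i₀, m (k i)) *
        (φ (∑ i, k i) * ψ (∑ i, k i ^ 3))) := by ring
    _ ≤ ((∏ i ∈ Finset.univ.erase i₀, expWeight μ Λ (k i)) *
          ENNReal.ofReal (Real.exp |∑ i, k i ^ 3|)) *
        (R (k i₀) * (∏ i ∈ Finset.univ.erase i₀, m (k i)) *
        (φ (∑ i, k i) * ψ (∑ i, k i ^ 3))) := by gcongr
    _ = _ := by ring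

lemma resForm_mono_ae {φ ψ : ℝ → ℝ≥0∞} {a b : Fin 4 ⊕ Fin 4 → ℝ → ℝ≥0∞}
    (h : ∀ i, a i ≤ᵐ[volume] b i) : resForm φ ψ a ≤ resForm φ ψ b := by
  have hae : ∀ᵐ k : Fin 4 ⊕ Fin 4 → ℝ, ∀ i, a i (k i) ≤ b i (k i) := by
    rw [ae_all_iff]
    intro i
    exact (Measure.quasiMeasurePreserving_eval
      (fun _ : Fin 4 ⊕ Fin 4 => (volume : Measure ℝ)) i).ae (h i)
  refine lintegral_mono_ae ?_
  filter_upwards [hae] with k hk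
  gcongr with i
  exact hk i

/-! ### Interaction of high and low frequencies -/

/-- The part of `h` at frequencies above `s`. -/
def highPart (s : ℝ) (h : ℝ → ℝ≥0∞) : ℝ → ℝ≥0∞ := {ξ : ℝ | s < |ξ|}.indicator h

/-- The part of `h` at frequencies up to `s`. -/
def lowPart (s : ℝ) (h : ℝ → ℝ≥0∞) : ℝ → ℝ≥0∞ := {ξ : ℝ | |ξ| ≤ s}.indicator h

lemma measurableSet_high (s : ℝ) : MeasurableSet {ξ : ℝ | s < |ξ|} :=
  measurableSet_lt measurable_const measurable_norm

lemma measurableSet_low (s : ℝ) : MeasurableSet {ξ : ℝ | |ξ| ≤ s} :=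
  measurableSet_le measurable_norm measurable_const

lemma measurable_highPart {s : ℝ} {h : ℝ → ℝ≥0∞} (hh : Measurable h) :
    Measurable (highPart s h) := hh.indicator (measurableSet_high s)

lemma measurable_lowPart {s : ℝ} {h : ℝ → ℝ≥0∞} (hh : Measurable h) :
    Measurable (lowPart s h) := hh.indicator (measurableSet_low s)

lemma lowPart_add_highPart (s : ℝ) (h : ℝ → ℝ≥0∞) : lowPart s h + highPart s h = h := by
  ext ξ
  rcases le_or_gt |ξ| s with hξ | hξ
  · simp [lowPart, highPart, hξ]
  · simp [lowPart, highPart, hξ, hξ.not_ge]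

lemma pairInt_le_low_add_high (s : ℝ) (R : ℝ → ℝ≥0∞) (hR : Measurable R) {h : ℝ → ℝ≥0∞}
    (hh : Measurable h) :
    pairInt R h ≤ pairInt R (lowPart s h) + pairInt R (highPart s h) := by
  have h1 := measurable_lowPart (s := s) hh
  unfold pairInt
  rw [← lintegral_add_left (by fun_prop)]
  refine lintegral_mono fun p => ?_
  rcases le_or_gt |p.2| s with hξ | hξ
  · simp [lowPart, highPart, hξ]
  · simp [lowPart, highPart, hξ, hξ.not_ge]

/-- The form with one high-frequency slot. Splitting a second slot into low and high frequencies,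
the first part is paired with the high-frequency slot; in the second the two high-frequency slots
are both paired with full ones. -/
theorem resForm_high_le {φ ψ : ℝ → ℝ≥0∞} (hφ : Measurable φ) (hψ : Measurable ψ)
    {h : ℝ → ℝ≥0∞} (hh : Measurable h) (s : ℝ) :
    resForm φ ψ (fun i => if i = .inl 0 then highPart s h else h) ≤
      2 * ((∫⁻ x, φ x) * ∫⁻ x, ψ x) *
        (pairInt (highPart s h) (lowPart s h) ^ (3 / 4 : ℝ) * (pairInt h h ^ (3 / 4 : ℝ)) ^ 3 +
          (pairInt (highPart s h) (lowPart s h) + pairInt (highPart s h) (highPart s h)) ^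
            (3 / 2 : ℝ) * (pairInt h h ^ (3 / 4 : ℝ)) ^ 2) := by
  have hL := measurable_lowPart (s := s) hh
  have hR := measurable_highPart (s := s) hh
  set R := highPart s h
  set L := lowPart s h
  set slots : (ℝ → ℝ≥0∞) → Fin 4 ⊕ Fin 4 → ℝ → ℝ≥0∞ := fun X =>
    Sum.elim ![R, h, h, h] ![X, h, h, h] with hslots
  set slots' : Fin 4 ⊕ Fin 4 → ℝ → ℝ≥0∞ := Sum.elim ![R, R, h, h] ![h, h, h, h] with hslots'
  have hsm : ∀ X, Measurable X → ∀ i, Measurable (slots X i) := by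
    rintro X hX (i | i) <;> fin_cases i <;> simp [hslots, hR, hh, hX]
  have hsm' : ∀ i, Measurable (slots' i) := by
    rintro (i | i) <;> fin_cases i <;> simp [hslots', hR, hh]
  have e0 : (fun i => if i = .inl 0 then R else h) = slots (L + R) := by
    funext i
    rw [lowPart_add_highPart]
    rcases i with i | i <;> fin_cases i <;> simp [hslots]
  have e1 : resForm φ ψ (slots (L + R)) = resForm φ ψ (slots L) + resForm φ ψ (slots R) := by
    unfold resForm
    rw [← lintegral_add_left]
    · refine lintegral_congr fun k => ?_
      simp only [hslots, Fintype.prod_sum_type, Fin.prod_univ_four, Sum.elim_inl, Sum.elim_inr]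
      simp only [Matrix.cons_val, Pi.add_apply]
      ring
    · have : ∀ i, Measurable fun k : Fin 4 ⊕ Fin 4 → ℝ => slots L i (k i) := fun i =>
        (hsm L hL i).comp (measurable_pi_apply i)
      fun_prop
  have e2 : resForm φ ψ (slots R) = resForm φ ψ slots' := by
    rw [← resForm_perm φ ψ slots' (Equiv.swap (.inr 0) (.inl 1))]
    congr 1
    funext i
    rcases i with i | i <;> fin_cases i <;> simp [hslots, hslots', Equiv.swap_apply_def]
  have b1 : resForm φ ψ (slots L) ≤ 2 * ((∫⁻ x, φ x) * ∫⁻ x, ψ x) *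
      (pairInt R L ^ (3 / 4 : ℝ) * (pairInt h h ^ (3 / 4 : ℝ)) ^ 3) := by
    refine (resForm_le hφ hψ (hsm L hL)).trans (le_of_eq ?_)
    congr 1
    simp only [hslots, Fin.prod_univ_four, Sum.elim_inl, Sum.elim_inr, Matrix.cons_val]
    ring
  have b2 : resForm φ ψ slots' ≤ 2 * ((∫⁻ x, φ x) * ∫⁻ x, ψ x) *
      ((pairInt R L + pairInt R R) ^ (3 / 2 : ℝ) * (pairInt h h ^ (3 / 4 : ℝ)) ^ 2) := by
    refine (resForm_le hφ hψ hsm').trans ?_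
    gcongr
    simp only [hslots', Fin.prod_univ_four, Sum.elim_inl, Sum.elim_inr, Matrix.cons_val]
    have e3 : (pairInt R L + pairInt R R) ^ (3 / 2 : ℝ) =
        (pairInt R L + pairInt R R) ^ (3 / 4 : ℝ) * (pairInt R L + pairInt R R) ^ (3 / 4 : ℝ) := by
      rw [← ENNReal.rpow_add_of_nonneg _ _ (by norm_num) (by norm_num)]
      norm_num
    rw [e3, sq, mul_assoc]
    gcongr
    all_goals exact pairInt_le_low_add_high s R hR hh
  rw [e0, e1, e2, mul_add]
  exact add_le_add b1 b2

lemma lintegral_sq_eq_low_add_high (s : ℝ) {h : ℝ → ℝ≥0∞} (hh : Measurable h) :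
    ∫⁻ ξ, h ξ ^ 2 = (∫⁻ ξ, lowPart s h ξ ^ 2) + ∫⁻ ξ, highPart s h ξ ^ 2 := by
  have h1 := measurable_lowPart (s := s) hh
  rw [← lintegral_add_left (by fun_prop)]
  refine lintegral_congr fun ξ => ?_
  rcases le_or_gt |ξ| s with hξ | hξ
  · simp [lowPart, highPart, hξ]
  · simp [lowPart, highPart, hξ, hξ.not_ge]

/-- The gain for pairs consisting of a frequency above `s²` and one below: frequencies below `s`
are separated from those above `s²` by a factor `s`, and the mass in between is small. -/
lemma pairInt_high_low_le {h : ℝ → ℝ≥0∞} (hh : Measurable h) {s : ℝ} (hs : 1 ≤ s) :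
    pairInt (highPart (s ^ 2) h) (lowPart (s ^ 2) h) ≤
      ((kernelInt (Set.Icc (-(1 / s)) (1 / s)) * kernelInt Set.univ) ^ (1 / 3 : ℝ) *
          (∫⁻ ξ, lowPart (s ^ 2) h ξ ^ 2) ^ (2 / 3 : ℝ) +
        kernelInt Set.univ ^ (2 / 3 : ℝ) *
          (∫⁻ ξ, highPart s (lowPart (s ^ 2) h) ξ ^ 2) ^ (2 / 3 : ℝ)) *
        (∫⁻ ξ, highPart (s ^ 2) h ξ ^ 2) ^ (2 / 3 : ℝ) := by
  have hL := measurable_lowPart (s := s ^ 2) hh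
  have hR := measurable_highPart (s := s ^ 2) hh
  have hs0 : 0 < s := by linarith
  refine (pairInt_le_low_add_high s _ hR hL).trans ?_
  rw [add_mul]
  refine add_le_add ?_ ?_
  · refine (pairInt_le (E := Set.Icc (-(1 / s)) (1 / s)) hR (measurable_lowPart hL)
      measurableSet_Icc ?_).trans ?_
    · intro k l hk hl
      have hk' : s ^ 2 < |k| := by
        by_contra hcon
        exact hk (by simp [highPart, hcon])
      have hl' : |l| ≤ s := by
        by_contra hcon
        exact hl (by simp [lowPart, hcon])
      rw [Set.mem_Icc, ← abs_le, abs_div, div_le_div_iff₀ (by nlinarith) hs0]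
      nlinarith [abs_nonneg l]
    · rw [mul_assoc, ENNReal.mul_rpow_of_nonneg _ _ (by norm_num : (0 : ℝ) ≤ 2 / 3), mul_comm
        ((∫⁻ ξ, highPart (s ^ 2) h ξ ^ 2) ^ (2 / 3 : ℝ))]
      gcongr with ξ
      exact Set.indicator_le_self _ _ _
  · refine (pairInt_le_univ hR (measurable_highPart hL)).trans (le_of_eq ?_)
    rw [ENNReal.mul_rpow_of_nonneg _ _ (by norm_num : (0 : ℝ) ≤ 2 / 3)]
    ring

/-! ### The bootstrap argument -/

/-- The quadratic trap: for small `κ`, the inequality forces a mass `V` in `[0, V₀]` to lie in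
`[0, V₀ / 4]`. -/
lemma exists_trap {ω a b d : ℝ≥0∞} (hω : ω ≠ 0) (hω' : ω ≠ ∞) (ha : a ≠ ∞) (hb : b ≠ ∞)
    (hd : d ≠ ∞) : ∃ V₀ : ℝ≥0∞, 0 < V₀ ∧ V₀ ≤ 1 ∧ ∃ κ₀ : ℝ≥0∞, 0 < κ₀ ∧ ∀ κ ≤ κ₀, ∀ V ≤ V₀,
      ω * V ≤ a * κ ^ (3 / 4 : ℝ) * V ^ (1 / 2 : ℝ) +
        b * (κ + d * V ^ (2 / 3 : ℝ)) ^ (3 / 2 : ℝ) * V →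
      V ≤ V₀ / 4 := by
  have hω2 : ω / 2 ≠ 0 := by simp [hω]
  have hrpow : ∀ y : ℝ, 0 < y → Tendsto (fun x : ℝ≥0∞ => x ^ y) (𝓝 0) (𝓝 0) := fun y hy => by
    have := (ENNReal.continuous_rpow_const (y := y)).tendsto 0
    rwa [ENNReal.zero_rpow_of_pos hy] at this
  have h1 : Tendsto (fun x : ℝ≥0∞ => b * (x + d * x ^ (2 / 3 : ℝ)) ^ (3 / 2 : ℝ)) (𝓝 0) (𝓝 0) := by
    have e1 := ENNReal.Tendsto.const_mul (hrpow (2 / 3) (by norm_num)) (a := d) (Or.inr hd)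
    have e2 := (tendsto_id (α := ℝ≥0∞) (x := 𝓝 0)).add e1
    simp only [mul_zero, add_zero, id] at e2
    have e3 := ENNReal.Tendsto.const_mul ((hrpow (3 / 2) (by norm_num)).comp e2) (a := b)
      (Or.inr hb)
    simpa [Function.comp_def] using e3
  obtain ⟨η, hη0, hη⟩ := ENNReal.nhds_zero_basis_Iic.eventually_iff.1
    (ENNReal.tendsto_nhds_zero.1 h1 (ω / 2) (pos_iff_ne_zero.2 hω2))
  set V₀ := min η 1 with hV₀
  have hV₀0 : 0 < V₀ := lt_min hη0 one_pos
  have hV₀t : V₀ ≠ ∞ := ((min_le_right η 1).trans_lt ENNReal.one_lt_top).ne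
  have h2 : Tendsto (fun x : ℝ≥0∞ => a * x ^ (3 / 4 : ℝ)) (𝓝 0) (𝓝 0) := by
    simpa using ENNReal.Tendsto.const_mul (hrpow (3 / 4) (by norm_num)) (a := a) (Or.inr ha)
  have hc : 0 < ω / 4 * V₀ ^ (1 / 2 : ℝ) := by
    refine ENNReal.mul_pos (by simp [hω]) ?_
    exact (ENNReal.rpow_pos hV₀0 hV₀t).ne'
  obtain ⟨κ₁, hκ₁0, hκ₁⟩ := ENNReal.nhds_zero_basis_Iic.eventually_iff.1
    (ENNReal.tendsto_nhds_zero.1 h2 _ hc)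
  refine ⟨V₀, hV₀0, min_le_right _ _, min κ₁ η, lt_min hκ₁0 hη0, fun κ hκ V hV hle => ?_⟩
  have hVη : V ≤ η := hV.trans (min_le_left _ _)
  have hκη : κ ≤ η := hκ.trans (min_le_right _ _)
  have hle2 : ω * V ≤ ω / 4 * V₀ ^ (1 / 2 : ℝ) * V ^ (1 / 2 : ℝ) + ω / 2 * V := by
    refine hle.trans (add_le_add ?_ ?_)
    · exact mul_le_mul_left (hκ₁ (Set.mem_Iic.2 (hκ.trans (min_le_left _ _)))) _
    · refine mul_le_mul_left (le_trans ?_ (hη (Set.mem_Iic.2 le_rfl))) _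
      gcongr
  -- in terms of the square roots `x = V^{1/2}`, `y = V₀^{1/2}` this reads `x² / 2 ≤ x y / 4`
  have hVt : V ≠ ∞ := (hV.trans_lt hV₀t.lt_top).ne
  have hsq : ∀ x : ℝ≥0∞, (x ^ (1 / 2 : ℝ)) ^ 2 = x := fun x => by
    rw [← ENNReal.rpow_natCast, ← ENNReal.rpow_mul]
    norm_num
  have hxt : V ^ (1 / 2 : ℝ) ≠ ∞ := ENNReal.rpow_ne_top_of_nonneg (by norm_num) hVt
  have hyt : V₀ ^ (1 / 2 : ℝ) ≠ ∞ := ENNReal.rpow_ne_top_of_nonneg (by norm_num) hV₀t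
  obtain ⟨x, hx⟩ : ∃ x, x = V ^ (1 / 2 : ℝ) := ⟨_, rfl⟩
  obtain ⟨y, hy⟩ : ∃ y, y = V₀ ^ (1 / 2 : ℝ) := ⟨_, rfl⟩
  rw [← hsq V, ← hsq V₀, ← hx, ← hy]
  have hle3 : ω * x ^ 2 ≤ ω / 4 * y * x + ω / 2 * x ^ 2 := by
    rw [hx, hy, hsq V]
    exact hle2
  rw [← hx] at hxt
  rw [← hy] at hyt
  have hω4t : ω / 4 ≠ ∞ := ENNReal.div_ne_top hω' (by norm_num)
  have hω2t : ω / 2 ≠ ∞ := ENNReal.div_ne_top hω' (by norm_num)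
  have h4 := ENNReal.toReal_mono (by finiteness) hle3
  rw [ENNReal.toReal_add (by finiteness) (by finiteness)] at h4
  simp only [ENNReal.toReal_mul, ENNReal.toReal_pow, ENNReal.toReal_div, ENNReal.toReal_ofNat]
    at h4
  rw [← ENNReal.toReal_le_toReal (by finiteness) (ENNReal.div_ne_top (by finiteness) (by norm_num))]
  simp only [ENNReal.toReal_pow, ENNReal.toReal_div, ENNReal.toReal_ofNat]
  have hωp : 0 < ω.toReal := ENNReal.toReal_pos hω hω'
  have hx0 : 0 ≤ x.toReal := ENNReal.toReal_nonneg
  have hy0 : 0 ≤ y.toReal := ENNReal.toReal_nonneg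
  have h5 : x.toReal ^ 2 ≤ y.toReal / 2 * x.toReal := by
    refine le_of_mul_le_mul_left ?_ hωp
    nlinarith
  have h6 : x.toReal ≤ y.toReal / 2 := by
    rcases hx0.eq_or_lt with h | h
    · rw [← h]
      positivity
    · exact le_of_mul_le_mul_right (by nlinarith) h
  nlinarith

/-- The sum of `|F|` and its reflection, an even majorant of `|F|`. -/
def evenMaj (F : ℝ → ℂ) (ξ : ℝ) : ℝ≥0∞ := ‖F ξ‖ₑ + ‖F (-ξ)‖ₑ

lemma measurable_evenMaj {F : ℝ → ℂ} (hF : Measurable F) : Measurable (evenMaj F) := by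
  unfold evenMaj
  exact hF.enorm.add (hF.comp measurable_neg).enorm

lemma add_sq_le_two_mul (x y : ℝ≥0∞) : (x + y) ^ 2 ≤ 2 * (x ^ 2 + y ^ 2) := by
  have := ENNReal.rpow_add_le_mul_rpow_add_rpow x y (p := 2) one_le_two
  norm_num at this
  exact this

lemma expWeight_neg (μ Λ ξ : ℝ) : expWeight μ Λ (-ξ) = expWeight μ Λ ξ := by
  rw [expWeight, cubicWeight_neg, expWeight]

lemma lintegral_highPart_evenMaj_le {F : ℝ → ℂ} (hF : Measurable F) (μ Λ s : ℝ) :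
    ∫⁻ ξ, highPart s (fun ξ => expWeight μ Λ ξ * evenMaj F ξ) ξ ^ 2 ≤
      4 * ∫⁻ ξ, highPart s (fun ξ => expWeight μ Λ ξ * ‖F ξ‖ₑ) ξ ^ 2 := by
  set q : ℝ → ℝ≥0∞ := fun ξ => highPart s (fun ξ => expWeight μ Λ ξ * ‖F ξ‖ₑ) ξ ^ 2 with hq
  have hFe := hF.enorm
  have hqm : Measurable q := (measurable_highPart (by fun_prop)).pow_const 2
  calc _ ≤ ∫⁻ ξ, 2 * (q ξ + q (-ξ)) := by
        refine lintegral_mono fun ξ => ?_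
        by_cases h : s < |ξ|
        · simp only [hq, highPart, Set.indicator, Set.mem_ofPred_eq, abs_neg, h, if_true, evenMaj,
            expWeight_neg, mul_add]
          refine (add_sq_le_two_mul _ _).trans (le_of_eq ?_)
          ring
        · simp [highPart, h]
    _ = _ := by
        rw [lintegral_const_mul _ (by fun_prop), lintegral_add_left hqm,
          lintegral_neg_eq_self q, ← two_mul, ← mul_assoc]
        norm_num

/-- Testing the Euler–Lagrange equation with the datum `e^{2G} f̂ 1_{|ξ| > s}`. -/
lemma weak_step {f : L2} {ω : ℝ} (hω : 0 < ω)
    (hf : ∀ g : L2, (ω : ℂ) * inner ℂ g f = airyForm ![g, f, f, f] ![f, f, f, f])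
    {μ Λ : ℝ} (hμ : 0 ≤ μ) (hμ1 : μ ≤ 1) (hΛ : 0 ≤ Λ) (s : ℝ) {X : ℝ≥0∞}
    (hX : ∀ δ : ℝ, 0 < δ → δ ≤ 1 → resForm (kernX δ)
      (fun q => ENNReal.ofReal (Real.exp |q|) * kernT δ q)
      (fun i => if i = .inl 0 then
        highPart s (fun ξ => expWeight μ Λ ξ * evenMaj (𝓕 f : L2) ξ)
        else fun ξ => expWeight μ Λ ξ * evenMaj (𝓕 f : L2) ξ) ≤ X) :
    ENNReal.ofReal ω *
      ∫⁻ ξ, highPart s (fun ξ => expWeight μ Λ ξ * evenMaj (𝓕 f : L2) ξ) ξ ^ 2 ≤ 4 * X := by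
  set F : ℝ → ℂ := ((𝓕 f : L2) : ℝ → ℂ) with hF
  have hFm : Measurable F := (Lp.stronglyMeasurable _).measurable
  have hF2 : MemLp F 2 := Lp.memLp _
  set S : Set ℝ := {ξ : ℝ | s < |ξ|} with hS
  have hSm : MeasurableSet S := measurableSet_high s
  set w : ℝ → ℝ := cubicWeight μ Λ with hw
  set Gf : ℝ → ℂ := S.indicator fun ξ => (Real.exp (2 * w ξ) : ℂ) * F ξ with hGf
  have hG2 : MemLp Gf 2 := by
    refine MemLp.indicator hSm ?_
    refine hF2.of_le_mul (c := Real.exp (2 * Λ))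
      ((Continuous.aestronglyMeasurable (by fun_prop)).mul hF2.1)
      (Eventually.of_forall fun ξ => ?_)
    rw [norm_mul, Complex.norm_real, Real.norm_of_nonneg (Real.exp_pos _).le]
    gcongr
    exact min_le_right _ _
  set g : L2 := 𝓕⁻ (hG2.toLp Gf) with hg
  have h𝓕g : 𝓕 g = hG2.toLp Gf := FourierTransform.fourier_fourierInv_eq _
  have hgae : ((𝓕 g : L2) : ℝ → ℂ) =ᵐ[volume] Gf := by
    rw [h𝓕g]
    exact hG2.coeFn_toLp
  have hinner : ‖(ω : ℂ) * inner ℂ g f‖ₑ = ENNReal.ofReal ω *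
      ∫⁻ ξ, highPart s (fun ξ => expWeight μ Λ ξ * ‖F ξ‖ₑ) ξ ^ 2 := by
    have hpt : ∀ ξ, inner ℂ (Gf ξ) (F ξ) =
        ((S.indicator (fun ξ => Real.exp (2 * w ξ) * ‖F ξ‖ ^ 2) ξ : ℝ) : ℂ) := by
      intro ξ
      by_cases h : ξ ∈ S
      · simp only [hGf, Set.indicator_of_mem h, RCLike.inner_apply, map_mul, Complex.conj_ofReal]
        push_cast
        rw [← Complex.mul_conj']
        ring
      · simp [hGf, h]
    have hint : Integrable fun ξ => inner ℂ (Gf ξ) (F ξ) := by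
      refine (L2.integrable_inner (𝕜 := ℂ) (𝓕 g) (𝓕 f)).congr ?_
      filter_upwards [hgae] with ξ hξ
      rw [hξ]
    rw [← Lp.inner_fourier_eq g f, L2.inner_def, enorm_mul]
    congr 1
    · rw [← ofReal_norm, Complex.norm_real, Real.norm_of_nonneg hω.le]
    have hnn : ∀ ξ, 0 ≤ S.indicator (fun ξ => Real.exp (2 * w ξ) * ‖F ξ‖ ^ 2) ξ := fun ξ =>
      Set.indicator_nonneg (fun ξ _ => by positivity) ξ
    have e1 : ∫ ξ, inner ℂ ((𝓕 g : L2) ξ) ((𝓕 f : L2) ξ) =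
        ∫ ξ, ((S.indicator (fun ξ => Real.exp (2 * w ξ) * ‖F ξ‖ ^ 2) ξ : ℝ) : ℂ) := by
      refine integral_congr_ae ?_
      filter_upwards [hgae] with ξ hξ
      rw [hξ, ← hpt]
    have hint' : Integrable fun ξ => S.indicator (fun ξ => Real.exp (2 * w ξ) * ‖F ξ‖ ^ 2) ξ := by
      simp_rw [hpt] at hint
      simpa using hint.re
    rw [e1, integral_complex_ofReal, ← ofReal_norm, Complex.norm_real,
      Real.norm_of_nonneg (integral_nonneg hnn),
      ofReal_integral_eq_lintegral_ofReal hint' (Eventually.of_forall hnn)]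
    refine lintegral_congr fun ξ => ?_
    by_cases h : ξ ∈ S
    · have h' : s < |ξ| := h
      simp only [highPart, Set.indicator, Set.mem_ofPred_eq, h', h, if_true, expWeight, ← hw]
      rw [← ofReal_norm, ← ENNReal.ofReal_mul (Real.exp_pos _).le, ← ENNReal.ofReal_pow
        (by positivity), mul_pow, ← Real.exp_nat_mul]
      norm_num
    · have h' : ¬ s < |ξ| := h
      simp [highPart, h, h']
  have hbound : ‖airyForm ![g, f, f, f] ![f, f, f, f]‖ₑ ≤ X := by
    refine enorm_airyForm_le fun δ hδ hδ1 => ?_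
    refine le_trans ?_ ((resForm_weight_le hμ hμ1 hΛ (kernX δ) (kernT δ) _ (evenMaj F)
      (.inl 0)).trans (hX δ hδ hδ1))
    refine resForm_mono_ae fun i => ?_
    have hpos : ∀ ξ, ‖F ξ‖ₑ ≤ evenMaj F ξ := fun ξ => le_self_add
    have hneg : ∀ ξ, ‖F (-ξ)‖ₑ ≤ evenMaj F ξ := fun ξ => le_add_self
    rcases i with i | i
    · fin_cases i
      · have hgn := (Measure.measurePreserving_neg (volume : Measure ℝ)).quasiMeasurePreserving.ae
          hgae
        filter_upwards [hgn] with ξ hξ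
        simp only [formData, Sum.elim_inl, Fin.zero_eta, Matrix.cons_val_zero, if_true]
        rw [hξ]
        by_cases h : s < |ξ|
        · have h1 : -ξ ∈ S := by simpa [hS] using h
          simp only [hGf, Set.indicator_of_mem h1, highPart, Set.indicator, Set.mem_ofPred_eq, h,
            if_true, enorm_mul]
          rw [← mul_assoc]
          gcongr
          · rw [expWeight, ← ENNReal.ofReal_mul (Real.exp_pos _).le, ← Real.exp_add, ← ofReal_norm,
              Complex.norm_real, Real.norm_of_nonneg (Real.exp_pos _).le, hw, cubicWeight_neg,
              two_mul]
          · exact hneg ξ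
        · have h1 : -ξ ∉ S := by simpa [hS] using h
          simp [hGf, h1]
      all_goals
        refine Eventually.of_forall fun ξ => ?_
        simp only [formData, Sum.elim_inl]
        exact hneg ξ
    · refine Eventually.of_forall fun ξ => ?_
      fin_cases i <;> exact hpos ξ
  rw [← hf g, hinner] at hbound
  calc _ ≤ ENNReal.ofReal ω * (4 *
        ∫⁻ ξ, highPart s (fun ξ => expWeight μ Λ ξ * ‖F ξ‖ₑ) ξ ^ 2) := by
        gcongr
        exact lintegral_highPart_evenMaj_le hFm μ Λ s
    _ = 4 * (ENNReal.ofReal ω *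
        ∫⁻ ξ, highPart s (fun ξ => expWeight μ Λ ξ * ‖F ξ‖ₑ) ξ ^ 2) := by ring
    _ ≤ 4 * X := by gcongr

lemma expWeight_mul_lowPart_le {μ Λ s : ℝ} (hμ : 0 ≤ μ) (hμs : μ * s ^ 6 ≤ 1)
    (m : ℝ → ℝ≥0∞) (ξ : ℝ) :
    lowPart (s ^ 2) (fun ξ => expWeight μ Λ ξ * m ξ) ξ ≤ ENNReal.ofReal (Real.exp 1) * m ξ := by
  by_cases h : |ξ| ≤ s ^ 2
  · simp only [lowPart, Set.indicator, Set.mem_ofPred_eq, h, if_true, expWeight]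
    gcongr
    refine (min_le_left _ _).trans (le_trans ?_ hμs)
    gcongr
    calc |ξ| ^ 3 ≤ (s ^ 2) ^ 3 := by gcongr
      _ = s ^ 6 := by ring
  · simp [lowPart, h]

/-- The interaction coefficient of the frequencies above `s²` with those below, in terms of the
mass `A` and of the mass `τ` of the frequencies above `s`. -/
def couplingConst (s : ℝ) (A τ : ℝ≥0∞) : ℝ≥0∞ :=
  (kernelInt (Set.Icc (-(1 / s)) (1 / s)) * kernelInt Set.univ) ^ (1 / 3 : ℝ) * A ^ (2 / 3 : ℝ) +
    kernelInt Set.univ ^ (2 / 3 : ℝ) * (ENNReal.ofReal (Real.exp 1) ^ 2 * τ) ^ (2 / 3 : ℝ)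

/-- A bound for `pairInt h h ^ (3 / 4)` in terms of a bound `B` for the mass of `h`. -/
def pairConst (B : ℝ≥0∞) : ℝ≥0∞ :=
  (kernelInt Set.univ ^ (2 / 3 : ℝ) * (B * B) ^ (2 / 3 : ℝ)) ^ (3 / 4 : ℝ)

/-- The mass `V` of the weighted high frequencies of a weak solution is controlled by itself, with
coefficients that are small for small `couplingConst` and `V`. -/
theorem weighted_mass_le {f : L2} {ω : ℝ} (hω : 0 < ω)
    (hf : ∀ g : L2, (ω : ℂ) * inner ℂ g f = airyForm ![g, f, f, f] ![f, f, f, f])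
    {μ Λ s : ℝ} (hμ : 0 ≤ μ) (hμ1 : μ ≤ 1) (hΛ : 0 ≤ Λ) (hs : 1 ≤ s) (hμs : μ * s ^ 6 ≤ 1)
    {A τ V : ℝ≥0∞}
    (hA : ENNReal.ofReal (Real.exp 1) ^ 2 * ∫⁻ ξ, evenMaj (𝓕 f : L2) ξ ^ 2 ≤ A)
    (hτ : ∫⁻ ξ, highPart s (evenMaj (𝓕 f : L2)) ξ ^ 2 ≤ τ)
    (hV : V = ∫⁻ ξ, highPart (s ^ 2) (fun ξ => expWeight μ Λ ξ * evenMaj (𝓕 f : L2) ξ) ξ ^ 2)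
    (hV1 : V ≤ 1) :
    ENNReal.ofReal ω * V ≤
      4 * (2 * (kernMass * kernMass)) * pairConst (A + 1) ^ 3 * couplingConst s A τ ^ (3 / 4 : ℝ) *
          V ^ (1 / 2 : ℝ) +
        4 * (2 * (kernMass * kernMass)) * pairConst (A + 1) ^ 2 *
          (couplingConst s A τ + kernelInt Set.univ ^ (2 / 3 : ℝ) * V ^ (2 / 3 : ℝ)) ^
            (3 / 2 : ℝ) * V := by
  have hFm : Measurable ((𝓕 f : L2) : ℝ → ℂ) := (Lp.stronglyMeasurable _).measurable
  set m := evenMaj ((𝓕 f : L2) : ℝ → ℂ) with hm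
  have hmm : Measurable m := measurable_evenMaj hFm
  set h : ℝ → ℝ≥0∞ := fun ξ => expWeight μ Λ ξ * m ξ with hh
  have hhm : Measurable h := by fun_prop
  set d := kernelInt Set.univ ^ (2 / 3 : ℝ) with hd
  have hlow : ∫⁻ ξ, lowPart (s ^ 2) h ξ ^ 2 ≤ A := by
    refine le_trans ?_ hA
    rw [← lintegral_const_mul _ (by fun_prop)]
    refine lintegral_mono fun ξ => ?_
    rw [← mul_pow]
    gcongr
    exact expWeight_mul_lowPart_le hμ hμs m ξ
  have hmid : ∫⁻ ξ, highPart s (lowPart (s ^ 2) h) ξ ^ 2 ≤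
      ENNReal.ofReal (Real.exp 1) ^ 2 * τ := by
    refine le_trans ?_ (mul_le_mul_right hτ _)
    rw [← lintegral_const_mul _ ((measurable_highPart hmm).pow_const 2)]
    refine lintegral_mono fun ξ => ?_
    rw [← mul_pow]
    gcongr
    by_cases hξ : s < |ξ|
    · simpa [highPart, hξ] using expWeight_mul_lowPart_le hμ hμs m ξ
    · simp [highPart, hξ]
  have hRL : pairInt (highPart (s ^ 2) h) (lowPart (s ^ 2) h) ≤
      couplingConst s A τ * V ^ (2 / 3 : ℝ) := by
    refine (pairInt_high_low_le hhm hs).trans ?_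
    rw [hV, couplingConst]
    gcongr
  have hRR : pairInt (highPart (s ^ 2) h) (highPart (s ^ 2) h) ≤
      d * V ^ (2 / 3 : ℝ) * V ^ (2 / 3 : ℝ) := by
    refine (pairInt_le_univ (measurable_highPart hhm) (measurable_highPart hhm)).trans ?_
    rw [← hV, ENNReal.mul_rpow_of_nonneg _ _ (by norm_num), mul_assoc]
  have hT : pairInt h h ^ (3 / 4 : ℝ) ≤ pairConst (A + 1) := by
    have hmass : ∫⁻ ξ, h ξ ^ 2 ≤ A + 1 := by
      rw [lintegral_sq_eq_low_add_high (s ^ 2) hhm, ← hV]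
      gcongr
    unfold pairConst
    gcongr
    refine (pairInt_le_univ hhm hhm).trans ?_
    gcongr
  have key := weak_step hω hf hμ hμ1 hΛ (s ^ 2) (X := 2 * (kernMass * kernMass) *
    ((couplingConst s A τ * V ^ (2 / 3 : ℝ)) ^ (3 / 4 : ℝ) * pairConst (A + 1) ^ 3 +
      (couplingConst s A τ * V ^ (2 / 3 : ℝ) + d * V ^ (2 / 3 : ℝ) * V ^ (2 / 3 : ℝ)) ^
        (3 / 2 : ℝ) *
        pairConst (A + 1) ^ 2)) (by
    intro δ hδ hδ1
    refine (resForm_high_le (measurable_kernX δ) (by fun_prop) hhm (s ^ 2)).trans ?_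
    gcongr
    · exact lintegral_kernX_le hδ hδ1
    · exact lintegral_exp_mul_kernT_le hδ hδ1)
  rw [← hV] at key
  refine key.trans (le_of_eq ?_)
  have e1 : (couplingConst s A τ * V ^ (2 / 3 : ℝ)) ^ (3 / 4 : ℝ) =
      couplingConst s A τ ^ (3 / 4 : ℝ) * V ^ (1 / 2 : ℝ) := by
    rw [ENNReal.mul_rpow_of_nonneg _ _ (by norm_num), ← ENNReal.rpow_mul]
    norm_num
  have e2 : (couplingConst s A τ * V ^ (2 / 3 : ℝ) + d * V ^ (2 / 3 : ℝ) * V ^ (2 / 3 : ℝ)) ^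
      (3 / 2 : ℝ) = (couplingConst s A τ + d * V ^ (2 / 3 : ℝ)) ^ (3 / 2 : ℝ) * V := by
    rw [← add_mul, ENNReal.mul_rpow_of_nonneg _ _ (by norm_num), ← ENNReal.rpow_mul]
    norm_num
  rw [e1, e2]
  ring

lemma kernMass_ne_top : kernMass ≠ ∞ := ENNReal.ofReal_ne_top

lemma pairConst_ne_top {B : ℝ≥0∞} (hB : B ≠ ∞) : pairConst B ≠ ∞ := by
  have := kernelInt_univ_lt_top.ne
  unfold pairConst
  refine ENNReal.rpow_ne_top_of_nonneg (by norm_num) (ENNReal.mul_ne_top ?_ ?_)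
  · exact ENNReal.rpow_ne_top_of_nonneg (by norm_num) this
  · exact ENNReal.rpow_ne_top_of_nonneg (by norm_num) (ENNReal.mul_ne_top hB hB)

lemma tendsto_kernelInt_Icc :
    Tendsto (fun n : ℕ => kernelInt (Set.Icc (-(1 / (n : ℝ))) (1 / n))) atTop (𝓝 0) := by
  refine ENNReal.tendsto_nhds_zero.2 fun ε hε => ?_
  obtain ⟨θ, hθ, hle⟩ := exists_kernelInt_Icc_le hε.ne'
  have h1 : Tendsto (fun n : ℕ => 1 / (n : ℝ)) atTop (𝓝 0) := tendsto_one_div_atTop_nhds_zero_nat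
  filter_upwards [h1.eventually_le_const hθ] with n hn
  refine le_trans (lintegral_mono_set ?_) hle
  exact Set.Icc_subset_Icc (neg_le_neg hn) hn

lemma tendsto_lintegral_highPart {m : ℝ → ℝ≥0∞} (hm : Measurable m) (hmt : ∫⁻ ξ, m ξ ^ 2 ≠ ∞) :
    Tendsto (fun n : ℕ => ∫⁻ ξ, highPart n m ξ ^ 2) atTop (𝓝 0) := by
  have := tendsto_lintegral_of_dominated_convergence (μ := volume)
    (F := fun (n : ℕ) ξ => highPart n m ξ ^ 2) (f := fun _ => 0) (fun ξ => m ξ ^ 2)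
    (fun n => (measurable_highPart hm).pow_const 2)
    (fun n => Eventually.of_forall fun ξ => by
      exact pow_le_pow_left' (Set.indicator_le_self _ _ _) 2) hmt
    (Eventually.of_forall fun ξ => by
      refine tendsto_const_nhds.congr' ?_
      filter_upwards [eventually_ge_atTop ⌈|ξ|⌉₊] with n hn
      have : ¬ (n : ℝ) < |ξ| := not_lt.2 (Nat.ceil_le.1 hn)
      simp [highPart, this])
  simpa using this

lemma tendsto_couplingConst {m : ℝ → ℝ≥0∞} (hm : Measurable m) (hmt : ∫⁻ ξ, m ξ ^ 2 ≠ ∞)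
    {A : ℝ≥0∞} (hA : A ≠ ∞) :
    Tendsto (fun n : ℕ => couplingConst n A (∫⁻ ξ, highPart n m ξ ^ 2)) atTop (𝓝 0) := by
  have hK := kernelInt_univ_lt_top.ne
  have hrpow : ∀ {u : ℕ → ℝ≥0∞} (y : ℝ), 0 < y → Tendsto u atTop (𝓝 0) →
      Tendsto (fun n => u n ^ y) atTop (𝓝 0) := fun y hy hu => by
    have := (ENNReal.continuous_rpow_const (y := y)).tendsto 0
    rw [ENNReal.zero_rpow_of_pos hy] at this
    exact this.comp hu
  have l1 := ENNReal.Tendsto.mul_const tendsto_kernelInt_Icc (b := kernelInt Set.univ) (Or.inr hK)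
  rw [zero_mul] at l1
  have l2 := ENNReal.Tendsto.const_mul (tendsto_lintegral_highPart hm hmt)
    (a := ENNReal.ofReal (Real.exp 1) ^ 2) (Or.inr (by finiteness))
  rw [mul_zero] at l2
  have h1 := ENNReal.Tendsto.mul_const (hrpow (1 / 3) (by norm_num) l1) (b := A ^ (2 / 3 : ℝ))
    (Or.inr (ENNReal.rpow_ne_top_of_nonneg (by norm_num) hA))
  have h2 := ENNReal.Tendsto.const_mul (hrpow (2 / 3) (by norm_num) l2)
    (a := kernelInt Set.univ ^ (2 / 3 : ℝ))
    (Or.inr (ENNReal.rpow_ne_top_of_nonneg (by norm_num) hK))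
  simpa [couplingConst] using h1.add h2

lemma expWeight_zero {μ : ℝ} (hμ : 0 ≤ μ) (ξ : ℝ) : expWeight μ 0 ξ = 1 := by
  have : cubicWeight μ 0 ξ = 0 := min_eq_right (by positivity)
  simp [expWeight, this]

lemma expWeight_add_log_two_le (μ Λ ξ : ℝ) :
    expWeight μ (Λ + Real.log 2) ξ ≤ 2 * expWeight μ Λ ξ := by
  have h : cubicWeight μ (Λ + Real.log 2) ξ ≤ Real.log 2 + cubicWeight μ Λ ξ := by
    have := Real.log_nonneg (one_le_two (α := ℝ))
    rw [cubicWeight, cubicWeight, ← min_add_add_left, add_comm Λ]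
    exact min_le_min (by linarith) le_rfl
  calc expWeight μ (Λ + Real.log 2) ξ ≤
        ENNReal.ofReal (Real.exp (Real.log 2 + cubicWeight μ Λ ξ)) :=
        ENNReal.ofReal_le_ofReal (Real.exp_le_exp.2 h)
    _ = 2 * expWeight μ Λ ξ := by
        rw [Real.exp_add, Real.exp_log two_pos, ENNReal.ofReal_mul two_pos.le, expWeight]
        simp

/-- The mass of the weighted high frequencies grows at most by a factor `4` when the truncation
level of the weight is raised by `log 2`. Hence it cannot jump across the gap left by
`exists_trap`, and it stays bounded for all truncation levels. -/
theorem exists_weighted_mass_bound {f : L2} (hf : IsWeakSolution f) :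
    ∃ μ : ℝ, 0 < μ ∧ ∃ C : ℝ≥0∞, C ≠ ∞ ∧ ∀ j : ℕ,
      ∫⁻ ξ, (expWeight μ (j * Real.log 2) ξ * evenMaj (𝓕 f : L2) ξ) ^ 2 ≤ C := by
  obtain ⟨ω, hω, hf⟩ := hf
  have hFm : Measurable ((𝓕 f : L2) : ℝ → ℂ) := (Lp.stronglyMeasurable _).measurable
  set m := evenMaj ((𝓕 f : L2) : ℝ → ℂ) with hm
  have hmm : Measurable m := measurable_evenMaj hFm
  have hmt : ∫⁻ ξ, m ξ ^ 2 ≠ ∞ := by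
    have h1 : ∫⁻ ξ, ‖(𝓕 f : L2) ξ‖ₑ ^ 2 ≠ ∞ := by
      rw [← eLpNorm_two_sq]
      exact ENNReal.pow_ne_top (Lp.memLp (𝓕 f)).2.ne
    have h2 : ∫⁻ ξ, m ξ ^ 2 ≤
        2 * ((∫⁻ ξ, ‖(𝓕 f : L2) ξ‖ₑ ^ 2) + ∫⁻ ξ, ‖(𝓕 f : L2) (-ξ)‖ₑ ^ 2) := by
      rw [← lintegral_add_left (by fun_prop), ← lintegral_const_mul _ (by fun_prop)]
      exact lintegral_mono fun ξ => add_sq_le_two_mul _ _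
    rw [lintegral_enorm_sq_neg] at h2
    exact ne_top_of_le_ne_top (by finiteness) h2
  set A : ℝ≥0∞ := ENNReal.ofReal (Real.exp 1) ^ 2 * ∫⁻ ξ, m ξ ^ 2 with hA
  have hAt : A ≠ ∞ := by finiteness
  have hpc := pairConst_ne_top (B := A + 1) (by finiteness)
  have hkm := kernMass_ne_top
  obtain ⟨V₀, hV₀, hV₀1, κ₀, hκ₀, htrap⟩ := exists_trap (ω := ENNReal.ofReal ω)
    (a := 4 * (2 * (kernMass * kernMass)) * pairConst (A + 1) ^ 3)
    (b := 4 * (2 * (kernMass * kernMass)) * pairConst (A + 1) ^ 2)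
    (d := kernelInt Set.univ ^ (2 / 3 : ℝ)) (by simpa using hω) ENNReal.ofReal_ne_top
    (by finiteness) (by finiteness)
    (ENNReal.rpow_ne_top_of_nonneg (by norm_num) kernelInt_univ_lt_top.ne)
  have hV₀4 : 0 < V₀ / 4 := ENNReal.div_pos hV₀.ne' (by norm_num)
  obtain ⟨n, hnκ, hnV, hn1⟩ := ((ENNReal.tendsto_nhds_zero.1 (tendsto_couplingConst hmm hmt hAt)
    κ₀ hκ₀).and ((ENNReal.tendsto_nhds_zero.1 (tendsto_lintegral_highPart hmm hmt) _ hV₀4).and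
    (eventually_ge_atTop 1))).exists
  have hs : (1 : ℝ) ≤ n := by exact_mod_cast hn1
  set s : ℝ := (n : ℝ)
  have hs6 : 1 ≤ s ^ 6 := one_le_pow₀ hs
  have hμ : 0 < (s ^ 6)⁻¹ := by positivity
  set μ : ℝ := (s ^ 6)⁻¹ with hμdef
  have hμs : μ * s ^ 6 ≤ 1 := (inv_mul_cancel₀ (by positivity)).le
  have hμ1 : μ ≤ 1 := inv_le_one_of_one_le₀ hs6
  have hlog := Real.log_nonneg (one_le_two (α := ℝ))
  have hVj : ∀ j : ℕ, ∫⁻ ξ, highPart (s ^ 2) (fun ξ => expWeight μ (j * Real.log 2) ξ * m ξ) ξ ^ 2 ≤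
      V₀ / 4 := by
    intro j
    induction j with
    | zero =>
      refine le_trans (lintegral_mono fun ξ => ?_) hnV
      simp only [Nat.cast_zero, zero_mul, expWeight_zero hμ.le, one_mul]
      gcongr
      refine Set.indicator_le_indicator_of_subset (fun ξ (hξ : s ^ 2 < |ξ|) => ?_)
        (fun _ => zero_le) ξ
      exact lt_of_le_of_lt (by nlinarith) hξ
    | succ j ih =>
      set V := ∫⁻ ξ, highPart (s ^ 2)
        (fun ξ => expWeight μ ((j + 1 : ℕ) * Real.log 2) ξ * m ξ) ξ ^ 2 with hV
      have h4 : V ≤ 4 * ∫⁻ ξ, highPart (s ^ 2)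
          (fun ξ => expWeight μ (j * Real.log 2) ξ * m ξ) ξ ^ 2 := by
        rw [← lintegral_const_mul _ ((measurable_highPart (by fun_prop)).pow_const 2)]
        refine lintegral_mono fun ξ => ?_
        have e : (4 : ℝ≥0∞) = 2 ^ 2 := by norm_num
        rw [e, ← mul_pow]
        gcongr
        by_cases hξ : s ^ 2 < |ξ|
        · simp only [highPart, Set.indicator, Set.mem_ofPred_eq, hξ, if_true]
          rw [← mul_assoc]
          gcongr
          rw [Nat.cast_succ, add_mul, one_mul]
          exact expWeight_add_log_two_le _ _ _
        · simp [highPart, hξ]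
      have hVV : V ≤ V₀ := by
        refine (h4.trans (mul_le_mul_right ih 4)).trans (le_of_eq ?_)
        exact ENNReal.mul_div_cancel (by norm_num) (by norm_num)
      refine htrap _ hnκ V hVV ?_
      exact weighted_mass_le hω hf hμ.le hμ1 (by positivity) hs hμs le_rfl le_rfl hV
        (hVV.trans hV₀1)
  refine ⟨μ, hμ, A + V₀ / 4, ENNReal.add_ne_top.2 ⟨hAt, ENNReal.div_ne_top
    (ne_top_of_le_ne_top ENNReal.one_ne_top hV₀1) (by norm_num)⟩, fun j => ?_⟩
  rw [lintegral_sq_eq_low_add_high (s ^ 2) (by fun_prop)]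
  refine add_le_add ?_ (hVj j)
  rw [hA, ← lintegral_const_mul _ (by fun_prop)]
  refine lintegral_mono fun ξ => ?_
  rw [← mul_pow]
  gcongr
  exact expWeight_mul_lowPart_le hμ.le hμs m ξ

/-- Cubic exponential decay of the Fourier transform, in Mathlib's normalisation. -/
theorem exists_memLp_exp_mul_fourier {f : L2} (hf : IsWeakSolution f) :
    ∃ μ : ℝ, 0 < μ ∧
      MemLp (fun ξ : ℝ => (Real.exp (μ * |ξ| ^ 3) : ℂ) * (𝓕 f : L2) ξ) 2 volume := by
  obtain ⟨μ, hμ, C, hC, hle⟩ := exists_weighted_mass_bound hf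
  have hFm : Measurable ((𝓕 f : L2) : ℝ → ℂ) := (Lp.stronglyMeasurable _).measurable
  have hmm := measurable_evenMaj hFm
  refine ⟨μ, hμ, ((Continuous.aestronglyMeasurable (by fun_prop)).mul hFm.aestronglyMeasurable), ?_⟩
  have h2 : eLpNorm (fun ξ : ℝ => (Real.exp (μ * |ξ| ^ 3) : ℂ) * (𝓕 f : L2) ξ) 2 volume ^ 2 ≤
      C := by
    rw [eLpNorm_two_sq]
    have hlim : ∀ ξ, liminf (fun j : ℕ =>
        (expWeight μ (j * Real.log 2) ξ * evenMaj (𝓕 f : L2) ξ) ^ 2) atTop =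
        (ENNReal.ofReal (Real.exp (μ * |ξ| ^ 3)) * evenMaj (𝓕 f : L2) ξ) ^ 2 := fun ξ => by
      refine Tendsto.liminf_eq (tendsto_const_nhds.congr' ?_)
      have h1 : Tendsto (fun j : ℕ => (j : ℝ) * Real.log 2) atTop atTop :=
        tendsto_natCast_atTop_atTop.atTop_mul_const (Real.log_pos one_lt_two)
      filter_upwards [h1.eventually_ge_atTop (μ * |ξ| ^ 3)] with j hj
      rw [expWeight, cubicWeight, min_eq_left hj]
    calc _ ≤ ∫⁻ ξ, liminf (fun j : ℕ =>
          (expWeight μ (j * Real.log 2) ξ * evenMaj (𝓕 f : L2) ξ) ^ 2) atTop := by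
          refine lintegral_mono fun ξ => ?_
          rw [hlim, enorm_mul, ← ofReal_norm, Complex.norm_real,
            Real.norm_of_nonneg (Real.exp_pos _).le]
          gcongr
          exact le_self_add
      _ ≤ liminf (fun j : ℕ => ∫⁻ ξ,
          (expWeight μ (j * Real.log 2) ξ * evenMaj (𝓕 f : L2) ξ) ^ 2) atTop :=
          lintegral_liminf_le fun j => by fun_prop
      _ ≤ liminf (fun _ : ℕ => C) atTop := liminf_le_liminf (Eventually.of_forall hle)
      _ = C := liminf_const C
  refine lt_top_iff_ne_top.2 fun htop => ?_
  rw [htop] at h2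
  exact hC (top_le_iff.1 (by simpa using h2))

/-! ### Consequences of cubic exponential decay -/

theorem hasCubicExpFourierDecay_of_memLp {f : L2} {μ : ℝ} (hμ : 0 < μ)
    (hf : MemLp (fun ξ : ℝ => (Real.exp (μ * |ξ| ^ 3) : ℂ) * (𝓕 f : L2) ξ) 2 volume) :
    HasCubicExpFourierDecay f := by
  have hFm : Measurable ((𝓕 f : L2) : ℝ → ℂ) := (Lp.stronglyMeasurable _).measurable
  refine ⟨μ / (2 * Real.pi) ^ 3, by positivity, ?_⟩
  have h1 : MemLp (fun k : ℝ => (Real.exp (μ * |k / (2 * Real.pi)| ^ 3) : ℂ) *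
      (𝓕 f : L2) (k / (2 * Real.pi))) 2 volume := by
    rw [memLp_two_iff_integrable_sq_norm hf.1] at hf
    have hm : AEStronglyMeasurable (fun k : ℝ => (Real.exp (μ * |k / (2 * Real.pi)| ^ 3) : ℂ) *
        (𝓕 f : L2) (k / (2 * Real.pi))) volume :=
      (Continuous.aestronglyMeasurable (by fun_prop)).mul
        (hFm.comp (measurable_id.div_const _)).aestronglyMeasurable
    rw [memLp_two_iff_integrable_sq_norm hm]
    exact hf.comp_div (by positivity)
  convert h1.const_mul (((√(2 * Real.pi))⁻¹ : ℝ) : ℂ) using 2 with k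
  have e : μ / (2 * Real.pi) ^ 3 * |k| ^ 3 = μ * |k / (2 * Real.pi)| ^ 3 := by
    rw [abs_div, abs_of_pos Real.two_pi_pos]
    field_simp
  rw [e, fourierHat]
  ring

/-- A cubic beats a linear term by more than a Gaussian. -/
lemma exists_linear_sub_cubic_le (c : ℝ) {μ : ℝ} (hμ : 0 < μ) :
    ∃ K : ℝ, ∀ r : ℝ, 0 ≤ r → c * r - μ * r ^ 3 ≤ K - r ^ 2 := by
  refine ⟨c ^ 2 / 2 + 3 / 2 * (3 / (2 * μ)) ^ 2, fun r hr => ?_⟩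
  have h1 : 3 / 2 * r ^ 2 ≤ μ * r ^ 3 + 3 / 2 * (3 / (2 * μ)) ^ 2 := by
    rcases le_total r (3 / (2 * μ)) with h | h
    · have h2 : r ^ 2 ≤ (3 / (2 * μ)) ^ 2 := by gcongr
      have h3 : 0 ≤ μ * r ^ 3 := by positivity
      linarith
    · rw [div_le_iff₀ (by positivity)] at h
      have h3 : 0 ≤ (3 / (2 * μ)) ^ 2 := by positivity
      nlinarith [mul_le_mul_of_nonneg_right h (sq_nonneg r)]
  nlinarith [sq_nonneg (c - r)]

lemma integrable_exp_mul_of_memLp {F : ℝ → ℂ} (hFm : Measurable F) {μ : ℝ} (hμ : 0 < μ)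
    (hF : MemLp (fun ξ : ℝ => (Real.exp (μ * |ξ| ^ 3) : ℂ) * F ξ) 2 volume) (c : ℝ) :
    Integrable fun ξ : ℝ => Real.exp (c * |ξ|) * ‖F ξ‖ := by
  obtain ⟨K, hK⟩ := exists_linear_sub_cubic_le c hμ
  have hg : MemLp (fun ξ : ℝ => Real.exp (-1 * ξ ^ 2)) 2 volume := by
    rw [memLp_two_iff_integrable_sq (Continuous.aestronglyMeasurable (by fun_prop))]
    refine (integrable_exp_neg_mul_sq two_pos).congr (Eventually.of_forall fun ξ => ?_)
    simp only [← Real.exp_nat_mul]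
    congr 1
    push_cast
    ring
  refine ((hF.norm.integrable_mul hg).const_mul (Real.exp K)).mono'
    ((Continuous.aestronglyMeasurable (by fun_prop)).mul hFm.norm.aestronglyMeasurable)
    (Eventually.of_forall fun ξ => ?_)
  rw [Real.norm_of_nonneg (by positivity)]
  simp only [Pi.mul_apply, norm_mul, Complex.norm_real, Real.norm_of_nonneg (Real.exp_pos _).le]
  calc Real.exp (c * |ξ|) * ‖F ξ‖ ≤
        Real.exp (K + (μ * |ξ| ^ 3 + -1 * ξ ^ 2)) * ‖F ξ‖ := by
        gcongr
        have := hK |ξ| (abs_nonneg _)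
        rw [sq_abs] at this
        linarith
    _ = _ := by
        rw [Real.exp_add, Real.exp_add]
        ring

lemma norm_cexp_mul_le (z : ℂ) (ξ : ℝ) :
    ‖Complex.exp (2 * Real.pi * Complex.I * z * ξ)‖ ≤ Real.exp (2 * Real.pi * ‖z‖ * |ξ|) := by
  refine (Complex.norm_exp_le_exp_norm _).trans (le_of_eq ?_)
  simp [Real.pi_pos.le, abs_of_nonneg]

/-- Differentiation under the integral sign, with a bound of the difference quotients that is
uniform on the unit disc around a point. -/
theorem differentiable_fourierLaplace {F : ℝ → ℂ} (hFm : Measurable F)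
    (hF : ∀ c : ℝ, Integrable fun ξ : ℝ => Real.exp (c * |ξ|) * ‖F ξ‖) :
    Differentiable ℂ fun z : ℂ => ∫ ξ : ℝ, Complex.exp (2 * Real.pi * Complex.I * z * ξ) * F ξ := by
  intro z₀
  have hmeas : ∀ z : ℂ, AEStronglyMeasurable
      (fun ξ : ℝ => Complex.exp (2 * Real.pi * Complex.I * z * ξ) * F ξ) := fun z =>
    (Continuous.aestronglyMeasurable (by fun_prop)).mul hFm.aestronglyMeasurable
  refine (hasDerivAt_integral_of_dominated_loc_of_deriv_le
    (F := fun (z : ℂ) (ξ : ℝ) => Complex.exp (2 * Real.pi * Complex.I * z * ξ) * F ξ)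
    (F' := fun (z : ℂ) (ξ : ℝ) => Complex.exp (2 * Real.pi * Complex.I * z * ξ) *
      (2 * Real.pi * Complex.I * ξ) * F ξ)
    (bound := fun ξ => 2 * Real.pi *
      (Real.exp ((2 * Real.pi * (‖z₀‖ + 1) + 1) * |ξ|) * ‖F ξ‖))
    (Metric.ball_mem_nhds z₀ one_pos) (Eventually.of_forall hmeas) ?_
    ((Continuous.aestronglyMeasurable (by fun_prop)).mul hFm.aestronglyMeasurable)
    ?_ ((hF _).const_mul _) ?_).2.differentiableAt
  · refine (hF (2 * Real.pi * ‖z₀‖)).mono' (hmeas z₀) (Eventually.of_forall fun ξ => ?_)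
    rw [norm_mul]
    gcongr
    exact norm_cexp_mul_le z₀ ξ
  · refine Eventually.of_forall fun ξ z hz => ?_
    have hz' : ‖z‖ ≤ ‖z₀‖ + 1 := by
      have h1 : ‖z - z₀‖ < 1 := by simpa [dist_eq_norm] using hz
      have h2 := norm_le_norm_add_norm_sub' z z₀
      linarith
    have e : ‖(2 * Real.pi * Complex.I * ξ : ℂ)‖ = 2 * Real.pi * |ξ| := by
      simp [Real.pi_pos.le, abs_of_nonneg]
    rw [norm_mul, norm_mul, e]
    calc _ ≤ Real.exp (2 * Real.pi * (‖z₀‖ + 1) * |ξ|) * (2 * Real.pi * Real.exp |ξ|) * ‖F ξ‖ := by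
          gcongr
          · refine (norm_cexp_mul_le z ξ).trans ?_
            gcongr
          · linarith [Real.add_one_le_exp |ξ|]
      _ = _ := by
          rw [add_mul, one_mul, Real.exp_add]
          ring
  · refine Eventually.of_forall fun ξ z _ => ?_
    have h1 : HasDerivAt (fun z : ℂ => 2 * Real.pi * Complex.I * z * ξ)
        (2 * Real.pi * Complex.I * ξ) z := by
      simpa using ((hasDerivAt_id z).const_mul (2 * Real.pi * Complex.I : ℂ)).mul_const (ξ : ℂ)
    exact h1.cexp.mul_const (F ξ)

theorem extendsToEntire_of_memLp {f : L2} {μ : ℝ} (hμ : 0 < μ)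
    (hf : MemLp (fun ξ : ℝ => (Real.exp (μ * |ξ| ^ 3) : ℂ) * (𝓕 f : L2) ξ) 2 volume) :
    ExtendsToEntire f := by
  have hFm : Measurable ((𝓕 f : L2) : ℝ → ℂ) := (Lp.stronglyMeasurable _).measurable
  have hint := integrable_exp_mul_of_memLp hFm hμ hf
  refine ⟨_, differentiable_fourierLaplace hFm hint, ?_⟩
  have hF1 : Integrable ((𝓕 f : L2) : ℝ → ℂ) := by
    refine (integrable_norm_iff hFm.aestronglyMeasurable).1 ?_
    simpa using hint 0
  have h := fourierInv_ae_eq hF1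
  rw [FourierTransform.fourierInv_fourier_eq] at h
  filter_upwards [h] with x hx
  rw [hx, Real.fourierInv_eq']
  refine integral_congr_ae (Eventually.of_forall fun ξ => ?_)
  simp only [smul_eq_mul, RCLike.inner_apply, conj_trivial]
  push_cast
  congr 2
  ring

/-! ### The Euler–Lagrange equation for extremisers -/

/-- The evolution is determined up to null sets by its time slices. -/
lemma evolution_ae_eq {h : L2} {U : ℝ × ℝ → ℂ} (hU : AEStronglyMeasurable U volume)
    (hae : ∀ᵐ t, airy t h =ᵐ[volume] fun x => U (t, x)) : evolution h =ᵐ[volume] U := by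
  have hm : AEStronglyMeasurable (evolution h - U) volume := (memLp_evolution h).1.sub hU
  have h0 : ∫⁻ p, ‖(evolution h - U) p‖ₑ = 0 := by
    have hm' := hm.enorm
    rw [Measure.volume_eq_prod] at hm' ⊢
    rw [lintegral_prod _ hm']
    rw [← lintegral_zero (μ := (volume : Measure ℝ))]
    refine lintegral_congr_ae ?_
    filter_upwards [hae, airy_ae_eq_evolution h] with t h1 h2
    rw [← lintegral_zero (μ := (volume : Measure ℝ))]
    refine lintegral_congr_ae ?_
    filter_upwards [h1, h2] with x hx1 hx2
    simp [← hx1, ← hx2]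
  rw [lintegral_eq_zero_iff' hm.enorm] at h0
  filter_upwards [h0] with p hp
  simpa [sub_eq_zero] using hp

lemma airy_smul (t : ℝ) (g : L2) (c : ℂ) : airy t (c • g) = c • airy t g := by
  have h0 : airy t 0 = 0 := by rw [← norm_eq_zero, norm_airy, norm_zero]
  simpa [h0] using airy_add_smul t 0 g c

lemma evolution_add_smul (f g : L2) (c : ℂ) :
    evolution (f + c • g) =ᵐ[volume] fun p => evolution f p + c * evolution g p := by
  refine evolution_ae_eq ((memLp_evolution f).1.add ((memLp_evolution g).1.const_mul c)) ?_
  filter_upwards [airy_ae_eq_evolution f, airy_ae_eq_evolution g] with t hf hg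
  rw [airy_add_smul]
  filter_upwards [hf, hg, Lp.coeFn_add (airy t f) (c • airy t g), Lp.coeFn_smul c (airy t g)]
    with x h1 h2 h3 h4
  rw [h3, Pi.add_apply, h4, Pi.smul_apply, h1, h2, smul_eq_mul]

lemma evolution_smul (g : L2) (c : ℂ) :
    evolution (c • g) =ᵐ[volume] fun p => c * evolution g p := by
  refine evolution_ae_eq ((memLp_evolution g).1.const_mul c) ?_
  filter_upwards [airy_ae_eq_evolution g] with t hg
  rw [airy_smul]
  filter_upwards [hg, Lp.coeFn_smul c (airy t g)] with x h2 h4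
  rw [h4, Pi.smul_apply, h2, smul_eq_mul]

lemma strichartzNorm_eq (f : L2) : strichartzNorm f = eLpNorm (evolution f) 8 volume := by
  have h8 : ∀ x : ℝ≥0∞, (x ^ (8 : ℝ)) ^ (1 / 8 : ℝ) = x := fun x => by
    rw [← ENNReal.rpow_mul]
    norm_num
  rw [← h8 (eLpNorm (evolution f) 8 volume), strichartzNorm]
  congr 1
  have hcast : ∀ x : ℝ≥0∞, x ^ (8 : ℝ) = x ^ 8 := fun x => by
    rw [← ENNReal.rpow_natCast]
    norm_num
  simp only [hcast, eLpNorm_eight_pow]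
  have hm := (memLp_evolution f).1.enorm.pow_const 8
  rw [Measure.volume_eq_prod] at hm ⊢
  rw [lintegral_prod _ hm]
  refine lintegral_congr_ae ?_
  filter_upwards [airy_ae_eq_evolution f] with t ht
  refine lintegral_congr_ae ?_
  filter_upwards [ht] with x hx
  rw [hx]

/-- The Strichartz inequality on `L²`. -/
theorem strichartzNorm_le (f : L2) : strichartzNorm f ≤ strichartzConst * ENNReal.ofReal ‖f‖ := by
  rw [strichartzNorm_eq]
  have hF2 : MemLp ((𝓕 f : L2) : ℝ → ℂ) 2 := Lp.memLp _
  have hFm : Measurable ((𝓕 f : L2) : ℝ → ℂ) := (Lp.stronglyMeasurable _).measurable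
  have hn : eLpNorm ((𝓕 f : L2) : ℝ → ℂ) 2 volume = ENNReal.ofReal ‖f‖ := by
    rw [← Lp.norm_fourier_eq f, Lp.norm_def, ENNReal.ofReal_toReal hF2.2.ne]
  have ht := (tendsto_evolution f).add_const (strichartzConst * ENNReal.ofReal ‖f‖)
  rw [zero_add] at ht
  refine ge_of_tendsto ht (Eventually.of_forall fun n => ?_)
  set W := wave (trunc (𝓕 f : L2) n) with hW
  have hWm : AEStronglyMeasurable W volume :=
    (continuous_wave (integrable_trunc hF2 n)).aestronglyMeasurable
  calc eLpNorm (evolution f) 8 volume = eLpNorm (evolution f - W + W) 8 volume := by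
        rw [sub_add_cancel]
    _ ≤ eLpNorm (evolution f - W) 8 volume + eLpNorm W 8 volume :=
        eLpNorm_add_le ((memLp_evolution f).1.sub hWm) hWm (by norm_num)
    _ ≤ _ := by
        rw [eLpNorm_sub_comm]
        gcongr
        refine (eLpNorm_wave_le (integrable_trunc hF2 n) (measurable_trunc hFm n)).trans ?_
        rw [← hn]
        gcongr
        exact eLpNorm_mono_enorm (enorm_trunc_le _ n)

lemma optimalConstant_ne_top : optimalConstant ≠ ∞ := by
  refine ne_top_of_le_ne_top strichartzConst_ne_top (iSup₂_le fun f hf => ?_)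
  simpa [hf] using strichartzNorm_le f

lemma strichartzNorm_le_optimalConstant (f : L2) :
    strichartzNorm f ≤ optimalConstant * ENNReal.ofReal ‖f‖ := by
  rcases eq_or_ne f 0 with rfl | hf
  · simpa using strichartzNorm_le 0
  have hf0 : 0 < ‖f‖ := norm_pos_iff.2 hf
  set g : L2 := ((‖f‖⁻¹ : ℝ) : ℂ) • f with hg
  have hg1 : ‖g‖ = 1 := by
    rw [hg, norm_smul, Complex.norm_real, norm_inv, norm_norm, inv_mul_cancel₀ hf0.ne']
  have hfg : f = ((‖f‖ : ℝ) : ℂ) • g := by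
    rw [hg, smul_smul, ← Complex.ofReal_mul, mul_inv_cancel₀ hf0.ne', Complex.ofReal_one, one_smul]
  calc strichartzNorm f = strichartzNorm (((‖f‖ : ℝ) : ℂ) • g) := by rw [← hfg]
    _ = ENNReal.ofReal ‖f‖ * strichartzNorm g := by
        rw [strichartzNorm_eq, strichartzNorm_eq, eLpNorm_congr_ae (evolution_smul g _)]
        have := eLpNorm_const_smul ((‖f‖ : ℝ) : ℂ) (evolution g) 8 volume
        simp only [Pi.smul_def, smul_eq_mul] at this
        rw [this, ← ofReal_norm, Complex.norm_real, norm_norm]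
    _ ≤ ENNReal.ofReal ‖f‖ * optimalConstant := by
        gcongr
        exact le_iSup₂_of_le (f := fun (f : L2) (_ : ‖f‖ = 1) => strichartzNorm f) g hg1 le_rfl
    _ = _ := mul_comm _ _

lemma integrable_norm_evolution_pow (f : L2) : Integrable fun p => ‖evolution f p‖ ^ 8 :=
  (memLp_evolution f).integrable_norm_pow (by norm_num)

lemma ofReal_integral_norm_evolution_pow (f : L2) :
    ENNReal.ofReal (∫ p, ‖evolution f p‖ ^ 8) = strichartzNorm f ^ 8 := by
  rw [ofReal_integral_eq_lintegral_ofReal (integrable_norm_evolution_pow f)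
    (Eventually.of_forall fun p => by positivity), strichartzNorm_eq, eLpNorm_eight_pow]
  refine lintegral_congr fun p => ?_
  rw [ENNReal.ofReal_pow (norm_nonneg _), ofReal_norm]

lemma integral_norm_evolution_pow_le (f : L2) :
    ∫ p, ‖evolution f p‖ ^ 8 ≤ optimalConstant.toReal ^ 8 * (‖f‖ ^ 2) ^ 4 := by
  rw [← ENNReal.ofReal_le_ofReal_iff (by positivity), ofReal_integral_norm_evolution_pow,
    ENNReal.ofReal_mul (by positivity), ENNReal.ofReal_pow ENNReal.toReal_nonneg,
    ENNReal.ofReal_toReal optimalConstant_ne_top, ← pow_mul, ENNReal.ofReal_pow (norm_nonneg _),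
    ← mul_pow]
  gcongr
  exact strichartzNorm_le_optimalConstant f

lemma integral_norm_evolution_pow_eq {f : L2} (hf : IsExtremiser f) :
    ∫ p, ‖evolution f p‖ ^ 8 = optimalConstant.toReal ^ 8 * (‖f‖ ^ 2) ^ 4 := by
  have h0 : 0 ≤ ∫ p, ‖evolution f p‖ ^ 8 := integral_nonneg fun p => by positivity
  rw [← ENNReal.ofReal_eq_ofReal_iff h0 (by positivity), ofReal_integral_norm_evolution_pow,
    ENNReal.ofReal_mul (by positivity), ENNReal.ofReal_pow ENNReal.toReal_nonneg,
    ENNReal.ofReal_toReal optimalConstant_ne_top, ← pow_mul, ENNReal.ofReal_pow (norm_nonneg _),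
    ← mul_pow, hf.2]

/-- If `𝒜` vanished, so would the evolution of `f`, while `e^{-t∂ₓ³}` is unitary and `f ≠ 0`. -/
lemma optimalConstant_pos {f : L2} (hf : IsExtremiser f) : 0 < optimalConstant.toReal := by
  refine ENNReal.toReal_pos (fun h => hf.1 ?_) optimalConstant_ne_top
  have h1 : eLpNorm (evolution f) 8 volume = 0 := by
    rw [← strichartzNorm_eq, hf.2, h, zero_mul]
  rw [eLpNorm_eq_zero_iff (memLp_evolution f).1 (by norm_num)] at h1
  rw [Measure.volume_eq_prod] at h1
  obtain ⟨t, h2, h3⟩ := ((Measure.ae_ae_of_ae_prod h1).and (airy_ae_eq_evolution f)).exists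
  rw [← norm_eq_zero, ← norm_airy t f, norm_eq_zero]
  refine Lp.ext ?_
  filter_upwards [h2, h3, Lp.coeFn_zero ℂ 2 volume] with x hx2 hx3 hx4
  rw [hx3, hx4, hx2]
  rfl

/-- The tangent-line inequality for the convex function `|·|⁸`. -/
lemma norm_pow_eight_add_le (a b : ℂ) (τ : ℝ) :
    ‖a‖ ^ 8 + 8 * τ * (‖a‖ ^ 6 * (conj b * a).re) ≤ ‖a + τ * b‖ ^ 8 := by
  have h1 : ‖a + τ * b‖ ^ 2 = ‖a‖ ^ 2 + 2 * τ * (conj b * a).re + τ ^ 2 * ‖b‖ ^ 2 := by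
    simp only [Complex.sq_norm, Complex.normSq_apply, Complex.add_re, Complex.add_im,
      Complex.mul_re, Complex.mul_im, Complex.conj_re, Complex.conj_im, Complex.ofReal_re,
      Complex.ofReal_im]
    ring
  have h2 : ∀ A B : ℝ, 0 ≤ A → 0 ≤ B → A ^ 4 + 4 * A ^ 3 * (B - A) ≤ B ^ 4 := fun A B hA hB => by
    have : 0 ≤ (B - A) ^ 2 * (B ^ 2 + 2 * A * B + 3 * A ^ 2) := by positivity
    nlinarith
  have h3 := h2 (‖a‖ ^ 2) (‖a + τ * b‖ ^ 2) (by positivity) (by positivity)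
  have h4 : 0 ≤ 4 * (‖a‖ ^ 2) ^ 3 * (τ ^ 2 * ‖b‖ ^ 2) := by positivity
  calc _ ≤ (‖a‖ ^ 2) ^ 4 + 4 * (‖a‖ ^ 2) ^ 3 * (‖a + τ * b‖ ^ 2 - ‖a‖ ^ 2) := by
        rw [h1]
        linarith
    _ ≤ (‖a + τ * b‖ ^ 2) ^ 4 := h3
    _ = _ := by ring

lemma prod_formFactor_eq (f g : L2) (p : ℝ × ℝ) :
    (∏ i, formFactor (fun l => evolution (![g, f, f, f] l))
        (fun l => evolution (![f, f, f, f] l)) i)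
      p = ((‖evolution f p‖ ^ 6 : ℝ) : ℂ) * (conj (evolution g p) * evolution f p) := by
  simp only [Finset.prod_apply, Fintype.prod_sum_type, Fin.prod_univ_four, formFactor,
    Sum.elim_inl, Sum.elim_inr, Matrix.cons_val]
  have : ((‖evolution f p‖ ^ 6 : ℝ) : ℂ) = (conj (evolution f p) * evolution f p) ^ 3 := by
    rw [Complex.conj_mul']
    push_cast
    ring
  rw [this]
  ring

lemma airyForm_smul_left (f g : L2) (c : ℂ) :
    airyForm ![c • g, f, f, f] ![f, f, f, f] = conj c * airyForm ![g, f, f, f] ![f, f, f, f] := by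
  rw [airyForm_eq_integral, airyForm_eq_integral, ← integral_const_mul]
  refine integral_congr_ae ?_
  filter_upwards [evolution_smul g c] with p hp
  rw [prod_formFactor_eq, prod_formFactor_eq, hp, map_mul]
  ring

/-- The first variation: `τ ↦ 𝒜⁸ ‖f + τ g‖⁸ - ‖e^{-t∂ₓ³} f‖₈⁸ - 8 τ Re Q(g, f, …, f)` is minimal
at `0`. -/
lemma re_airyForm_eq {f : L2} (hf : IsExtremiser f) (g : L2) :
    (airyForm ![g, f, f, f] ![f, f, f, f]).re =
      optimalConstant.toReal ^ 8 * (‖f‖ ^ 2) ^ 3 * (inner ℂ g f).re := by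
  set a := optimalConstant.toReal ^ 8 with ha
  have hint := integrable_prod_formFactor (fun l => memLp_evolution (![g, f, f, f] l))
    (fun l => memLp_evolution (![f, f, f, f] l))
  have hre : (airyForm ![g, f, f, f] ![f, f, f, f]).re =
      ∫ p, ‖evolution f p‖ ^ 6 * (conj (evolution g p) * evolution f p).re := by
    rw [airyForm_eq_integral]
    refine (integral_re hint).symm.trans (integral_congr_ae (Eventually.of_forall fun p => ?_))
    simp only [prod_formFactor_eq, RCLike.re_eq_complex_re, Complex.re_ofReal_mul]
  have hint' : Integrable fun p =>
      ‖evolution f p‖ ^ 6 * (conj (evolution g p) * evolution f p).re := by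
    refine hint.re.congr (Eventually.of_forall fun p => ?_)
    simp only [prod_formFactor_eq, RCLike.re_eq_complex_re, Complex.re_ofReal_mul]
  set b := (airyForm ![g, f, f, f] ![f, f, f, f]).re with hb
  set r := (inner ℂ g f).re with hr
  set P : ℝ → ℝ := fun τ => a * (‖f‖ ^ 2 + 2 * τ * r + τ ^ 2 * ‖g‖ ^ 2) ^ 4 -
    (a * (‖f‖ ^ 2) ^ 4 + 8 * τ * b) with hP
  have hP0 : ∀ τ, P 0 ≤ P τ := by
    intro τ
    have e0 : P 0 = 0 := by simp [hP]
    rw [e0, hP, sub_nonneg]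
    have hnorm : ‖f + (τ : ℂ) • g‖ ^ 2 = ‖f‖ ^ 2 + 2 * τ * r + τ ^ 2 * ‖g‖ ^ 2 := by
      rw [norm_add_sq (𝕜 := ℂ), inner_smul_right, norm_smul, Complex.norm_real, mul_pow,
        Real.norm_eq_abs, sq_abs, RCLike.re_eq_complex_re, Complex.re_ofReal_mul, hr,
        ← inner_conj_symm f g, Complex.conj_re]
      ring
    rw [← hnorm, ← integral_norm_evolution_pow_eq hf, hre]
    refine le_trans ?_ (integral_norm_evolution_pow_le _)
    rw [← integral_const_mul, ← integral_add (integrable_norm_evolution_pow f)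
      (hint'.const_mul _)]
    refine integral_mono_ae ((integrable_norm_evolution_pow f).add (hint'.const_mul _))
      (integrable_norm_evolution_pow _) ?_
    filter_upwards [evolution_add_smul f g τ] with p hp
    rw [hp]
    exact norm_pow_eight_add_le _ _ _
  have hd : HasDerivAt P (a * (4 * (‖f‖ ^ 2) ^ 3 * (2 * r)) - 8 * b) 0 := by
    have h1 : HasDerivAt (fun τ : ℝ => ‖f‖ ^ 2 + 2 * τ * r + τ ^ 2 * ‖g‖ ^ 2) (2 * r) 0 := by
      have := ((((hasDerivAt_id (0 : ℝ)).const_mul 2).mul_const r).const_add (‖f‖ ^ 2)).fun_add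
        (((hasDerivAt_id (0 : ℝ)).pow 2).mul_const (‖g‖ ^ 2))
      simpa using this
    have h2 : HasDerivAt (fun τ : ℝ => a * (‖f‖ ^ 2) ^ 4 + 8 * τ * b) (8 * b) 0 := by
      simpa using (((hasDerivAt_id (0 : ℝ)).const_mul 8).mul_const b).const_add (a * (‖f‖ ^ 2) ^ 4)
    simpa using ((h1.pow 4).const_mul a).fun_sub h2
  have hmin : IsLocalMin P 0 := Eventually.of_forall hP0
  have := hmin.hasDerivAt_eq_zero hd
  linarith

theorem isWeakSolution_of_isExtremiser {f : L2} (hf : IsExtremiser f) : IsWeakSolution f := by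
  have hA := optimalConstant_pos hf
  have hf0 : 0 < ‖f‖ := norm_pos_iff.2 hf.1
  refine ⟨optimalConstant.toReal ^ 8 * (‖f‖ ^ 2) ^ 3, by positivity, fun g => ?_⟩
  apply Complex.ext
  · rw [Complex.re_ofReal_mul, re_airyForm_eq hf]
  · -- testing with `i g` gives the imaginary part
    have h := re_airyForm_eq hf (Complex.I • g)
    rw [airyForm_smul_left, inner_smul_left] at h
    simp only [Complex.conj_I, neg_mul, Complex.neg_re, Complex.I_mul_re, neg_neg] at h
    rw [Complex.im_ofReal_mul, h]

/-- Weak solutions have cubic exponential Fourier decay and extend to entire functions. -/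
theorem decay_and_entire_of_isWeakSolution {f : L2} (hf : IsWeakSolution f) :
    HasCubicExpFourierDecay f ∧ ExtendsToEntire f := by
  obtain ⟨μ, hμ, h⟩ := exists_memLp_exp_mul_fourier hf
  exact ⟨hasCubicExpFourierDecay_of_memLp hμ h, extendsToEntire_of_memLp hμ h⟩

end AiryStrichartz

end

theorem mainTheorem2 :
    (∀ f : AiryStrichartz.L2, AiryStrichartz.IsExtremiser f →
      AiryStrichartz.HasCubicExpFourierDecay f ∧ AiryStrichartz.ExtendsToEntire f) ∧
    (∀ f : AiryStrichartz.L2, AiryStrichartz.IsWeakSolution f →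
      AiryStrichartz.HasCubicExpFourierDecay f ∧ AiryStrichartz.ExtendsToEntire f) := by
  exact ⟨fun f hf => AiryStrichartz.decay_and_entire_of_isWeakSolution
      (AiryStrichartz.isWeakSolution_of_isExtremiser hf),
    fun f hf => AiryStrichartz.decay_and_entire_of_isWeakSolution hf⟩
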